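/- **Setting.** Let $d\in\mathbb N$ and let $P$ be a Borel probability measure on $\mathbb R^d$. For every $n\ge1$ let $I_n$ be a finite non-empty set, $k_n=|I_n|$, let $(S_n,d_n)$ be a non-empty compact metric space with Borel $\sigma$-algebra $\mathcal B_n$, with $\sup_n\operatorname{diam}(S_n)<\infty$, and let $\psi_n:(\mathbb R^d)^{I_n}\times S_n\to\mathbb R$ be measurable with respect to (the $P^{\otimes I_n}$-completion of the Borel $\sigma$-algebra) $\otimes\,\mathcal B_n$. Let $X^n=(X_{n,i})_{i\in I_n}$ be i.i.d. with law $P$, put $\psi_{n,\mathrm{opt}}(x)=\inf_{\omega\in S_n}\psi_n(x;\omega)\in[-\infty,\infty)$, and for $\theta>0$ let $$N_{n,\theta}=\{\omega\in S_n:\psi_n(X^n;\omega)\le\psi_{n,\mathrm{opt}}(X^n)+\theta\}.$$ For $T\subseteq S_n$ and a (pseudo-)metric $\rho$ on $S_n$, $\mathrm P(T,\rho,\delta)$ is the largest cardinality of a subset of $T$ whose distinct points are at $\rho$-distance $>\delta$. Assume: * (Uniqueness) for every $n$, almost surely $\psi_n(X^n;\cdot)$ has a unique minimizer; * (Measurability)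 for every $n$, $\psi_{n,\mathrm{opt}}$, and the minimizer as a function on the set of $x$ at which it exists and is unique, are measurable with respect to the completed $\sigma$-algebra, and $\psi_{n,\mathrm{opt}}(X^n)$ is integrable; * (Rejection condition) $P$ has a Lebesgue density $f$ such that for each $p\ge0$ there is $C(f,p)\in(0,\infty)$ with $\mathbb E\big[\|W\|_2^p\,(1-f(X+sW)/f(X))_+\big]\le C(f,p)\,s$ for all $s\ge0$, where $X\sim P$ and $W$ is an independent standard Gaussian vector in $\mathbb R^d$. **Part 1 (general theorem).** Suppose there are a finite number $L$, measurable functions $H_{n,i}:(\mathbb R^d)^{I_n}\times S_n\to\mathbb R^d$ $(i\in I_n)$, $R_{n,j}:(\mathbb R^d)^{I_n}\times(\mathbb R^d)^{I_n}\times S_n\to[0,\infty)$ and $\widetilde R_{n,j}:(\mathbb R^d)^{I_n}\to[0,\infty)$ $(1\le j\le L)$, and constants $\upsilon_j\in(0,\infty)$ with: * (B1) for every $n$, for Lebesgue-almost every $(x,c)$ the following holds for all $\omega\in S_n$: $\psi_n(x+c;\omega)-\psi_n(x;\omega)\le\sum_{i}c_i\cdot H_{n,i}(x;\omega)+\sum_{j=1}^LR_{n,j}(x,c;\omega)\,\widetilde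 R_{n,j}(x+c)$; * either (B2) $R_{n,j}(x,sc;\omega)=s^{1+\upsilon_j}R_{n,j}(x,c;\omega)$ for all $s>0$ and all $n,j,x,c,\omega$; or (B2$'$) $R_{n,j}(x,s\tilde c;\omega)\le s^{1+\upsilon_j}R_{n,j}(x,c;\omega)$ for all $s>0$, all $n,j,x,\omega$ and all $c,\tilde c$ with $\|\tilde c_i\|_2\le\|c_i\|_2$ for every $i\in I_n$. Let $\theta_n,\tau_n,\varsigma_n,\nu_{n,j},\tilde\nu_{n,j}>0$, $\lambda\in[0,\infty)$, $\gamma_j\in[0,\infty]$, $\varepsilon_0>0$ be such that (expectations are outer expectations if measurability is not known; exponents $0$ and $\infty$ are read as usual, as essential suprema): * (C1) $\big(\mathbb E\sup_{\omega\in N_{n,\theta_n}}\sum_i\|H_{n,i}(X^n;\omega)\|_2^{(1+\lambda)/\lambda}\big)^{\lambda/(1+\lambda)}=O(\varsigma_n)$, which for $\lambda=0$ means $\big\|\sup_{\omega\in N_{n,\theta_n}}\sup_i\|H_{n,i}(X^n;\omega)\|_2\big\|_{L^\infty}=O(\varsigma_n)$; * (C2) for every $j$, $\big[\mathbb E\,\widetilde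 R_{n,j}(X^n)^{1+\gamma_j}\big]^{1/(1+\gamma_j)}=O(\tilde\nu_{n,j})$ and $\big[\mathbb E\sup_{\omega\in N_{n,\theta_n}}R_{n,j}(X^n,\widetilde W^n;\omega)^{(1+\gamma_j)/\gamma_j}\big]^{\gamma_j/(1+\gamma_j)}=O(\nu_{n,j})$; in case (B2) the latter is assumed for every sequence $\widetilde W^n=(\widetilde W_{n,i})_{i\in I_n}$ such that $\{(X_{n,i},\widetilde W_{n,i})\}_{i\in I_n}$ is i.i.d. and each $\widetilde W_{n,i}$ is a mean-zero vector in $\mathbb R^d$ whose coordinates are sub-Gaussian with variance proxy $1$; in case (B2$'$) it is assumed only for $\widetilde W^n$ consisting of independent standard Gaussian vectors independent of $X^n$; * (C3) with $d_{2,n}(\omega_1,\omega_2)=\big(\sum_i\|H_{n,i}(X^n;\omega_1)-H_{n,i}(X^n;\omega_2)\|_2^2\big)^{1/2}$, for all $\varepsilon\in(0,\varepsilon_0)$ and $\delta>0$ there are $\kappa>0$ and $K\in\mathbb N$ with $\limsup_{n}\mathbb P\big[\mathrm P(N_{n,\theta_n},d_n,\varepsilon)>K\,\mathrm P(N_{n,\theta_n},d_{2,n},\tau_n\kappa)\big]\le\delta$;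 * (C4) $\displaystyle\theta_n=O\Big(\tau_n\min\Big\{\frac{\tau_n^{1+\lambda}}{k_n\varsigma_n^{1+\lambda}},\ \min_{1\le j\le L}\Big(\frac{\tau_n}{\nu_{n,j}\tilde\nu_{n,j}}\Big)^{1/\upsilon_j}\Big\}\Big)$. Then $\{\mathrm P(N_{n,\theta_n},d_n,\varepsilon):n\ge1\}$ is tight for every $\varepsilon>0$. **Part 2 (linear case).** Suppose instead that $\psi_n(x;\omega)=\sum_{i\in I_n}x_i\cdot H_{n,i}(\omega)$ for all $x,\omega$, with measurable $H_{n,i}:S_n\to\mathbb R^d$. Let $\theta_n,\tau_n,\varsigma_n>0$, $\lambda\in[0,\infty)$, $\varepsilon_0>0$ be such that * (D1) $\big(\sup_{\omega\in S_n}\sum_i\|H_{n,i}(\omega)\|_2^{(1+\lambda)/\lambda}\big)^{\lambda/(1+\lambda)}=O(\varsigma_n)$, which for $\lambda=0$ means $\sup_{\omega\in S_n}\sup_i\|H_{n,i}(\omega)\|_2=O(\varsigma_n)$; * (D2) with $d_{2,n}(\omega_1,\omega_2)=\big(\sum_i\|H_{n,i}(\omega_1)-H_{n,i}(\omega_2)\|_2^2\big)^{1/2}$,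 for every $\varepsilon\in(0,\varepsilon_0)$ there are $\kappa>0$ and $K\in\mathbb N$ with $\mathrm P(B,d_n,\varepsilon)\le K\,\mathrm P(B,d_{2,n},\tau_n\kappa)$ for all $n$ and all $B\subseteq S_n$; * $\theta_n=O\big(\tau_n^{2+\lambda}k_n^{-1}\varsigma_n^{-1-\lambda}\big)$. Then $\{\mathrm P(N_{n,\theta_n},d_n,\varepsilon):n\ge1\}$ is tight for every $\varepsilon>0$. -/

import Mathlib

open MeasureTheory ProbabilityTheory Filter Asymptotics
open scoped ENNReal NNReal

noncomputable section

namespace NearOpt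

/-- The input space `ℝ^d` with its Euclidean norm. -/
abbrev Vec (d : ℕ) : Type := EuclideanSpace ℝ (Fin d)

/-- The product law `P^{⊗ I}`: the law of an i.i.d. collection `(X_i)_{i ∈ I}` with distribution
`P`. -/
abbrev iidLaw {α : Type*} [MeasurableSpace α] (I : Type*) [Fintype I] (P : Measure α) :
    Measure (I → α) :=
  Measure.pi fun _ : I => P

/-! ### Packing numbers, tightness, outer expectations -/

/-- The `δ`-packing number of `T` with respect to `dst` (a metric or a pseudo-metric):
the largest cardinality of a subset of `T` whose distinct points are at distance `> δ`. -/
def packingNumber {S : Type*} (dst : S → S → ℝ) (δ : ℝ) (T : Set S) : ℕ∞ :=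
  ⨆ (C : Set S) (_ : C ⊆ T) (_ : C.Pairwise fun s t => δ < dst s t), C.encard

/-- For a metric, this is Mathlib's packing number. -/
theorem packingNumber_dist {S : Type*} [PseudoMetricSpace S] (δ : ℝ≥0) (T : Set S) :
    packingNumber (fun s t : S => dist s t) δ T = Metric.packingNumber δ T := by
  have h : ∀ C : Set S, (C.Pairwise fun s t => (δ : ℝ) < dist s t) ↔
      Metric.IsSeparated (δ : ℝ≥0∞) C := by
    intro C
    have h2 : ∀ s t : S, ((δ : ℝ) < dist s t) ↔ ((δ : ℝ≥0∞) < edist s t) := by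
      intro s t
      rw [edist_nndist, ENNReal.coe_lt_coe, ← coe_nndist, NNReal.coe_lt_coe]
    simp only [Metric.IsSeparated, h2]
  simp only [packingNumber, Metric.packingNumber, h]

/-- Tightness of a family of `ℕ∞`-valued random variables `Z_n`, each living on a probability
space `(Ω_n, μ_n)`. -/
def IsTightFamily {Ω : ℕ → Type*} [∀ n, MeasurableSpace (Ω n)] (μ : ∀ n, Measure (Ω n))
    (Z : ∀ n, Ω n → ℕ∞) : Prop :=
  ∀ η : ℝ, 0 < η → ∃ M : ℕ, ∀ n, μ n {x | (M : ℕ∞) < Z n x} ≤ ENNReal.ofReal η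

/-- The (outer) expectation of a `[0,∞]`-valued function; it is the usual expectation as soon as
the function is almost everywhere measurable (`outerExp_eq_lintegral`). It is used for suprema
over random subsets of an uncountable parameter space. -/
def outerExp {Ω : Type*} [MeasurableSpace Ω] (μ : Measure Ω) (g : Ω → ℝ≥0∞) : ℝ≥0∞ :=
  ⨅ (h : Ω → ℝ≥0∞) (_ : Measurable h) (_ : ∀ x, g x ≤ h x), ∫⁻ x, h x ∂μ

theorem outerExp_eq_lintegral {Ω : Type*} [MeasurableSpace Ω] (μ : Measure Ω) (g : Ω → ℝ≥0∞)
    (hg : AEMeasurable g μ) : outerExp μ g = ∫⁻ x, g x ∂μ := by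
  apply le_antisymm
  · -- redefine the measurable modification as `∞` on a measurable null set
    set N : Set Ω := toMeasurable μ {x | ¬ g x = hg.mk g x} with hN
    have hN0 : μ N = 0 := by
      rw [hN, measure_toMeasurable]
      exact hg.ae_eq_mk
    have hNm : MeasurableSet N := measurableSet_toMeasurable _ _
    classical
    set h : Ω → ℝ≥0∞ := N.piecewise (fun _ => ∞) (hg.mk g) with hh
    have hm : Measurable h := Measurable.piecewise hNm measurable_const hg.measurable_mk
    have hle : ∀ x, g x ≤ h x := by
      intro x
      by_cases hx : x ∈ N
      · simp [hh, hx]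
      · have : g x = hg.mk g x := by
          by_contra hne
          exact hx (subset_toMeasurable _ _ hne)
        simp [hh, hx, this]
    have hae : h =ᵐ[μ] g := by
      have h1 : ∀ᵐ x ∂μ, x ∉ N := measure_eq_zero_iff_ae_notMem.mp hN0
      filter_upwards [h1, hg.ae_eq_mk] with x hx hx2
      simp [hh, hx, hx2]
    calc outerExp μ g ≤ ∫⁻ x, h x ∂μ :=
          iInf_le_of_le h (iInf_le_of_le hm (iInf_le _ hle))
      _ = ∫⁻ x, g x ∂μ := lintegral_congr_ae hae
  · exact le_iInf fun h => le_iInf fun _ => le_iInf fun hle => lintegral_mono hle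

/-- The `L^p`-norm, `p ∈ (0, ∞]`, of a `[0,∞]`-valued function (`p = ∞` is the essential
supremum). -/
def outerLp {Ω : Type*} [MeasurableSpace Ω] (μ : Measure Ω) (p : ℝ≥0∞) (g : Ω → ℝ≥0∞) : ℝ≥0∞ :=
  if p = ∞ then essSup g μ else (outerExp μ fun x => g x ^ p.toReal) ^ (1 / p.toReal)

/-- `a_n = O(b_n)` for a `[0,∞]`-valued sequence `a` and positive real numbers `b_n`. -/
def IsBigOSeq (a : ℕ → ℝ≥0∞) (b : ℕ → ℝ) : Prop :=
  ∃ C : ℝ≥0, ∀ᶠ n in atTop, a n ≤ C * ENNReal.ofReal (b n)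

/-! ### One random minimization problem

`I` is the index set of the inputs, `S` the parameter space, `ψ` the objective function and
`P` the input law. The inputs are realized on the canonical space `(ℝ^d)^I` with law `P^{⊗ I}`. -/

section Problem

variable {d : ℕ} {I S : Type*}

/-- The optimal value `inf_ω ψ(x; ω) ∈ [-∞, ∞)`. -/
def optValue (ψ : (I → Vec d) → S → ℝ) (x : I → Vec d) : EReal :=
  ⨅ ω : S, (ψ x ω : EReal)

/-- The near optimal set `N_θ = {ω | ψ(x; ω) ≤ ψ_opt(x) + θ}`. -/
def nearOptimal (ψ : (I → Vec d) → S → ℝ) (θ : ℝ) (x : I → Vec d) : Set S :=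
  {ω | (ψ x ω : EReal) ≤ optValue ψ x + (θ : EReal)}

/-- The inputs at which the minimum is attained at exactly one parameter. -/
def uniqueSet (ψ : (I → Vec d) → S → ℝ) : Set (I → Vec d) :=
  {x | ∃! ω : S, (ψ x ω : EReal) = optValue ψ x}

/-- The optimizer, as a function on `uniqueSet ψ`. -/
def optimizer (ψ : (I → Vec d) → S → ℝ) (x : uniqueSet ψ) : S :=
  Classical.choose x.2.exists

variable [Fintype I]

/-- The completion of the product `σ`-algebra on `(ℝ^d)^I` with respect to `P^{⊗ I}`. -/
abbrev completedSigma (I : Type*) [Fintype I] (P : Measure (Vec d)) : MeasurableSpace (I → Vec d) :=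
  inferInstanceAs (MeasurableSpace (NullMeasurableSpace (I → Vec d) (iidLaw I P)))

/-- Measurability of the objective with respect to (completed inputs) `⊗` (Borel sets of `S`). -/
def ObjectiveMeasurable [MeasurableSpace S] (P : Measure (Vec d))
    (ψ : (I → Vec d) → S → ℝ) : Prop :=
  Measurable[(completedSigma I P).prod (inferInstance : MeasurableSpace S)]
    (fun z : (I → Vec d) × S => ψ z.1 z.2)

/-- Almost surely there is a unique minimizer. -/
def UniqueMinimizer (P : Measure (Vec d)) (ψ : (I → Vec d) → S → ℝ) : Prop :=
  ∀ᵐ x ∂(iidLaw I P), x ∈ uniqueSet ψ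

/-- Measurability of the optimal value and of the optimizer, and integrability of the
optimal value. Under `UniqueMinimizer` the optimal value is a.s. a real number, so that
`EReal.toReal` loses nothing. -/
structure OptimumMeasurable [MeasurableSpace S] (P : Measure (Vec d))
    (ψ : (I → Vec d) → S → ℝ) : Prop where
  optValue_measurable : Measurable[completedSigma I P] (optValue ψ)
  optimizer_measurable :
    Measurable[(completedSigma I P).comap (Subtype.val : uniqueSet ψ → (I → Vec d))]
      (optimizer ψ)
  optValue_finite : ∀ᵐ x ∂(iidLaw I P), optValue ψ x ≠ ⊥
  optValue_integrable : Integrable (fun x => (optValue ψ x).toReal) (iidLaw I P)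

/-- The pseudo-metric `(∑ i, ‖h_i(ω₁) - h_i(ω₂)‖²)^{1/2}` on `S`. -/
def gradDist (h : I → S → Vec d) (ω₁ ω₂ : S) : ℝ :=
  Real.sqrt (∑ i, ‖h i ω₁ - h i ω₂‖ ^ 2)

/-- `(E sup_{ω ∈ T(x)} ∑ i, ‖h_i(x; ω)‖^{(1+l)/l})^{l/(1+l)}`; for `l = 0` the essential supremum
of `sup_{ω ∈ T(x)} sup_i ‖h_i(x; ω)‖`. -/
def gradSize (P : Measure (Vec d)) (T : (I → Vec d) → Set S)
    (h : I → (I → Vec d) → S → Vec d) (l : ℝ) : ℝ≥0∞ :=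
  if l = 0 then essSup (fun x => ⨆ ω ∈ T x, ⨆ i, ‖h i x ω‖ₑ) (iidLaw I P)
  else (outerExp (iidLaw I P) fun x => ⨆ ω ∈ T x, ∑ i, ‖h i x ω‖ₑ ^ ((1 + l) / l)) ^ (l / (1 + l))

/-- The non-random analogue over the whole parameter space:
`(sup_ω ∑ i, ‖h_i(ω)‖^{(1+l)/l})^{l/(1+l)}`; for `l = 0` it is `sup_ω sup_i ‖h_i(ω)‖`. -/
def gradSizeLinear (h : I → S → Vec d) (l : ℝ) : ℝ≥0∞ :=
  if l = 0 then ⨆ ω, ⨆ i, ‖h i ω‖ₑ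
  else (⨆ ω, ∑ i, ‖h i ω‖ₑ ^ ((1 + l) / l)) ^ (l / (1 + l))

/-- `[E sup_{ω ∈ T(X)} r(X, W; ω)^{(1+γ)/γ}]^{γ/(1+γ)}`, where `(X_i, W_i)_i` is i.i.d. with
law `ρ` and `γ ∈ [0, ∞]`. The exponent `(1+γ)/γ` is written `1 + γ⁻¹`: it is `∞` for `γ = 0`
and `1` for `γ = ∞`. -/
def remainderSize (ρ : Measure (Vec d × Vec d)) (T : (I → Vec d) → Set S)
    (r : (I → Vec d) → (I → Vec d) → S → ℝ≥0) (γ : ℝ≥0∞) : ℝ≥0∞ :=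
  outerLp (iidLaw I ρ) (1 + γ⁻¹) fun z =>
    ⨆ ω ∈ T (fun i => (z i).1), (r (fun i => (z i).1) (fun i => (z i).2) ω : ℝ≥0∞)

/-- The Taylor-like upper expansion
`ψ(x + c; ω) - ψ(x; ω) ≤ ∑ i, c_i · h_i(x; ω) + ∑ j, r_j(x, c; ω) r'_j(x + c)`,
for all `(x, c)` outside a Lebesgue null set not depending on `ω`, and all `ω`. -/
def TaylorUpper {L : ℕ} (ψ : (I → Vec d) → S → ℝ) (h : I → (I → Vec d) → S → Vec d)
    (r : Fin L → (I → Vec d) → (I → Vec d) → S → ℝ≥0) (r' : Fin L → (I → Vec d) → ℝ≥0) : Prop :=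
  ∀ᵐ z : (I → Vec d) × (I → Vec d) ∂volume, ∀ ω : S,
    ψ (z.1 + z.2) ω - ψ z.1 ω ≤
      ∑ i, inner ℝ (z.2 i) (h i z.1 ω) + ∑ j, (r j z.1 z.2 ω : ℝ) * (r' j (z.1 + z.2) : ℝ)

/-- Homogeneity of degree `1 + υ` of the remainder in its second argument. -/
def Homogeneous (r : (I → Vec d) → (I → Vec d) → S → ℝ≥0) (υ : ℝ) : Prop :=
  ∀ (x c : I → Vec d) (s : ℝ), 0 < s → ∀ ω,
    (r x (s • c) ω : ℝ) = s ^ (1 + υ) * (r x c ω : ℝ)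

/-- The stronger, monotone version of `Homogeneous`. -/
def MonotoneHomogeneous (r : (I → Vec d) → (I → Vec d) → S → ℝ≥0) (υ : ℝ) : Prop :=
  ∀ (x c c' : I → Vec d) (s : ℝ), 0 < s → (∀ i, ‖c' i‖ ≤ ‖c i‖) → ∀ ω,
    (r x (s • c') ω : ℝ) ≤ s ^ (1 + υ) * (r x c ω : ℝ)

end Problem

/-! ### Conditions on the laws -/

/-- `P` has a density `f` such that, for `X ∼ P` and an independent standard Gaussian `W`,
`E[‖W‖^p (1 - f(X + sW)/f(X))₊] ≤ C(f, p) s` for all `p, s ≥ 0`. -/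
def RejectionCondition {d : ℕ} (P : Measure (Vec d)) : Prop :=
  ∃ f : Vec d → ℝ, Measurable f ∧ (∀ x, 0 ≤ f x) ∧
    P = volume.withDensity (fun x => ENNReal.ofReal (f x)) ∧
    ∀ p : ℝ, 0 ≤ p → ∃ C : ℝ, 0 < C ∧ ∀ s : ℝ, 0 ≤ s →
      ∫ z : Vec d × Vec d, ‖z.2‖ ^ p * max (1 - f (z.1 + s • z.2) / f z.1) 0
        ∂(P.prod (stdGaussian (Vec d))) ≤ C * s

/-- `ρ` is the joint law of a pair `(X, W)` where `X ∼ P` and `W` is a mean-zero random vector each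
coordinate of which is sub-Gaussian with variance proxy `1`. -/
structure IsSubGaussianPair {d : ℕ} (P : Measure (Vec d)) (ρ : Measure (Vec d × Vec d)) : Prop where
  isProbabilityMeasure : IsProbabilityMeasure ρ
  fst_eq : ρ.map Prod.fst = P
  integrable : ∀ a : Fin d, Integrable (fun z : Vec d × Vec d => z.2 a) ρ
  mean_zero : ∀ a : Fin d, ∫ z : Vec d × Vec d, z.2 a ∂ρ = 0
  subGaussian : ∀ a : Fin d, HasSubgaussianMGF (fun z : Vec d × Vec d => z.2 a) 1 ρ

end NearOpt

end

/-!
The near optimal set cannot be large, because otherwise a small random perturbation of the inputs,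
under which the mean of the optimal value is invariant, would lower this mean.

Let `x` have law `P^{⊗ I}` and move it to `x + sV`, where the pair of old and new inputs is
exchangeable and `V` is close to a family `w` of independent standard Gaussian vectors. The optimal
value has the same mean before and after. Every `ω` in the near optimal set of `x` is a candidate
after the move, so the expansion bounds the increment of the optimal value by
`θ + s ∑ i, w_i · H_i(x; ω)` plus errors. Given `x` this is a Gaussian process indexed by the near
optimal set, with canonical pseudo-metric `gradDist`. Since the bound holds for all `ω` at once, the
increment is at most `θ` plus errors minus `s` times the maximum of a process with the same law. If
the near optimal set contains many points at mutual distance `δ`, the expected maximum exceeds any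
prescribed multiple `B δ` of `δ` (`soft_sudakov`). As the increment has mean zero, this happens with
probability at most `(θ + errors) / (s B δ)`, see `measure_le_packingNumber_nearOptimal_le`.

* The minoration. Gaussian integration by parts shows that the mean energy of the Gibbs measure on
  the separated points is `β` times an expected variance (`integral_gibbs_energy`), and exponential
  moments show that the Gibbs measure is not concentrated (`integral_sum_gibbs_sq_le`). No rate is
  needed, only that the bound tends to infinity with the number of points.
* The perturbation. The proposal `x + sw` is accepted as in the Metropolis algorithm, so that the
  rejection condition controls the size of the rejected proposals. Rejected moves are resampled
  within small cells, which keeps the joint law of `x` and `sV` absolutely continuous and `V`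
  dominated by `w` (`isReversibleMove_move`). It follows that `V` is centered and sub-Gaussian
  (`IsReversibleMove.isSubGaussianPair`), as the moment conditions on the remainders require.
* The errors. The rejected proposals are paired with the gradients, and the two factors of the
  remainders with each other, by Hölder's inequality (`exists_dominating_gradient`,
  `lintegral_mul_le_of_lpBound`). Outer expectations are replaced by measurable dominating
  functions.
* The step size. If `s` is the minimum in the growth condition on `θ`, then `θ` and all errors are
  of the order `τ s` (`error_div_le`). With `δ = τ κ` the probability is of order `1 / (B κ)`, which
  is small for large `B`. The comparison condition then transfers tightness from `gradDist` to the
  given metrics (`isTightFamily_of_comparison`).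

The linear theorem is the case without remainder terms.
-/

noncomputable section

namespace NearOpt

/-! ### Gaussian integration by parts -/

/-- Stein's identity for bounded functions with bounded derivative. -/
theorem integral_mul_gaussianReal_eq_integral_deriv {F F' : ℝ → ℝ} {C : ℝ}
    (hF : ∀ x, HasDerivAt F (F' x) x) (hFm' : Measurable F')
    (hb : ∀ x, |F x| ≤ C) (hb' : ∀ x, |F' x| ≤ C) :
    ∫ x, x * F x ∂(gaussianReal 0 1) = ∫ x, F' x ∂(gaussianReal 0 1) := by
  have hFc : Continuous F := continuous_iff_continuousAt.mpr fun x => (hF x).continuousAt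
  have hpdf : ∀ x, HasDerivAt (fun y => -gaussianPDFReal 0 1 y) (x * gaussianPDFReal 0 1 x) x := by
    intro x
    have h1 : HasDerivAt (fun y : ℝ => -y ^ 2 / 2) (-x) x := by
      have := ((hasDerivAt_pow 2 x).neg).div_const 2
      convert! this using 1
      simp; ring
    have h2 := (h1.exp.const_mul ((√(2 * Real.pi))⁻¹)).neg
    convert! h2 using 1
    · ext y; simp [gaussianPDFReal]
    · simp [gaussianPDFReal]; ring
  have hgi : Integrable (fun x : ℝ => x) (gaussianReal 0 1) := IsGaussian.integrable_fun_id
  have hi1 : Integrable (fun x => x * gaussianPDFReal 0 1 x) volume := by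
    rw [gaussianReal_of_var_ne_zero 0 one_ne_zero] at hgi
    rw [integrable_withDensity_iff_integrable_smul' (measurable_gaussianPDF 0 1)
      (ae_of_all _ fun _ => gaussianPDF_lt_top)] at hgi
    simpa [toReal_gaussianPDF, mul_comm] using hgi
  rw [integral_gaussianReal_eq_integral_smul one_ne_zero,
    integral_gaussianReal_eq_integral_smul one_ne_zero]
  have key := integral_mul_deriv_eq_deriv_mul_of_integrable (u := F) (u' := F')
    (v := fun y => -gaussianPDFReal 0 1 y) (v' := fun x => x * gaussianPDFReal 0 1 x)
    (fun x _ => hF x) (fun x _ => hpdf x) ?_ ?_ ?_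
  · calc _ = ∫ x, F x * (x * gaussianPDFReal 0 1 x) := by
          congr 1; ext x; simp only [smul_eq_mul]; ring
      _ = _ := key
      _ = _ := by
          rw [← integral_neg]; congr 1; ext x; simp only [smul_eq_mul]; ring
  · exact hi1.bdd_mul hFc.aestronglyMeasurable (ae_of_all _ hb)
  · exact (integrable_gaussianPDFReal 0 1).neg.bdd_mul hFm'.aestronglyMeasurable (ae_of_all _ hb')
  · exact (integrable_gaussianPDFReal 0 1).neg.bdd_mul hFc.aestronglyMeasurable (ae_of_all _ hb)

/-- Replacing one coordinate of a random vector with independent coordinates by a fresh copy does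
not change its law. -/
theorem measurePreserving_update {ι : Type*} [Fintype ι] [DecidableEq ι] {α : ι → Type*}
    [∀ i, MeasurableSpace (α i)] (μ : ∀ i, Measure (α i)) [∀ i, IsProbabilityMeasure (μ i)]
    (k : ι) :
    MeasurePreserving (fun z : (∀ i, α i) × α k => Function.update z.1 k z.2)
      ((Measure.pi μ).prod (μ k)) (Measure.pi μ) := by
  have hm : Measurable (fun z : (∀ i, α i) × α k => Function.update z.1 k z.2) := by
    rw [measurable_pi_iff]
    intro i
    by_cases h : i = k
    · subst h; simpa using measurable_snd
    · simp only [Function.update_of_ne h]; fun_prop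
  refine ⟨hm, (Measure.pi_eq fun s hs => ?_).symm⟩
  rw [Measure.map_apply hm (MeasurableSet.univ_pi hs)]
  have : (fun z : (∀ i, α i) × α k => Function.update z.1 k z.2) ⁻¹' (Set.univ.pi s) =
      (Set.univ.pi (Function.update s k Set.univ)) ×ˢ (s k) := by
    ext ⟨w, x⟩
    simp only [Set.mem_preimage, Set.mem_pi, Set.mem_univ, true_imp_iff, Set.mem_prod]
    constructor
    · intro h
      refine ⟨fun i => ?_, by simpa using h k⟩
      by_cases hi : i = k
      · subst hi; simp
      · simpa [hi] using h i
    · rintro ⟨h, hk⟩ i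
      by_cases hi : i = k
      · subst hi; simpa using hk
      · simpa [hi] using h i
  rw [this, Measure.prod_prod, Measure.pi_pi, ← Finset.mul_prod_erase _ _ (Finset.mem_univ k),
    ← Finset.mul_prod_erase (f := fun i => μ i (s i)) _ (Finset.mem_univ k)]
  simp only [Function.update_self, measure_univ, one_mul]
  rw [mul_comm]
  congr 1
  refine Finset.prod_congr rfl fun i hi => ?_
  rw [Function.update_of_ne (Finset.ne_of_mem_erase hi)]

/-- Gaussian integration by parts in the coordinate `k`; the derivative in this coordinate is
expressed through `Function.update`. -/
theorem integral_eval_mul_pi_gaussianReal {ι : Type*} [Fintype ι] [DecidableEq ι] (k : ι)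
    {F F' : (ι → ℝ) → ℝ} {C : ℝ} (hFm : Measurable F) (hFm' : Measurable F')
    (hF : ∀ w x, HasDerivAt (fun y => F (Function.update w k y)) (F' (Function.update w k x)) x)
    (hb : ∀ w, |F w| ≤ C) (hb' : ∀ w, |F' w| ≤ C) :
    ∫ w, w k * F w ∂(Measure.pi fun _ : ι => gaussianReal 0 1) =
      ∫ w, F' w ∂(Measure.pi fun _ : ι => gaussianReal 0 1) := by
  set μ := Measure.pi fun _ : ι => gaussianReal 0 1 with hμ
  have hup := measurePreserving_update (fun _ : ι => gaussianReal 0 1) k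
  have hi : Integrable (fun w : ι → ℝ => w k) μ :=
    integrable_eval (μ := fun _ : ι => gaussianReal 0 1) (i := k) IsGaussian.integrable_fun_id
  have hi1 : Integrable (fun w : ι → ℝ => w k * F w) μ := by
    simp only [mul_comm]
    exact hi.bdd_mul hFm.aestronglyMeasurable (ae_of_all _ hb)
  have hi2 : Integrable F' μ :=
    Integrable.of_bound hFm'.aestronglyMeasurable C (ae_of_all _ hb')
  have h1 : ∀ G : (ι → ℝ) → ℝ, Integrable G μ → ∫ w, G w ∂μ =
      ∫ w, ∫ x, G (Function.update w k x) ∂(gaussianReal 0 1) ∂μ := by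
    intro G hG
    have hG' : Integrable G (Measure.map (fun z : (ι → ℝ) × ℝ => Function.update z.1 k z.2)
        (μ.prod (gaussianReal 0 1))) := by rw [hup.map_eq]; exact hG
    have h2 := integral_map hup.measurable.aemeasurable hG'.1
    rw [hup.map_eq] at h2
    rw [hμ, h2, integral_prod]
    exact (integrable_map_measure hG'.1 hup.measurable.aemeasurable).1 hG'
  rw [h1 _ hi1, h1 _ hi2]
  refine integral_congr_ae (ae_of_all _ fun w => ?_)
  simp only [Function.update_self]
  refine integral_mul_gaussianReal_eq_integral_deriv (C := C) (hF w) ?_ (fun _ => hb _)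
    (fun _ => hb' _)
  exact hFm'.comp (measurable_update w)

/-! ### Gibbs weights and a soft Sudakov minoration -/

section Gibbs

variable {ι J : Type*} [Fintype ι] [Fintype J]

/-- The Gibbs weight of the point `t j` at inverse temperature `β` in the linear potential `w`. -/
def gibbs (β : ℝ) (t : J → ι → ℝ) (j : J) (w : ι → ℝ) : ℝ :=
  Real.exp (β * ∑ k, w k * t j k) / ∑ l, Real.exp (β * ∑ k, w k * t l k)

variable (β : ℝ) (t : J → ι → ℝ)

theorem gibbs_nonneg (j : J) (w : ι → ℝ) : 0 ≤ gibbs β t j w := by unfold gibbs; positivity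

theorem sum_exp_pos [Nonempty J] (w : ι → ℝ) : 0 < ∑ l, Real.exp (β * ∑ k, w k * t l k) :=
  Finset.sum_pos (fun _ _ => Real.exp_pos _) Finset.univ_nonempty

theorem sum_gibbs [Nonempty J] (w : ι → ℝ) : ∑ j, gibbs β t j w = 1 := by
  unfold gibbs
  rw [← Finset.sum_div, div_self (sum_exp_pos β t w).ne']

theorem gibbs_le_one [Nonempty J] (j : J) (w : ι → ℝ) : gibbs β t j w ≤ 1 := by
  rw [← sum_gibbs β t w]
  exact Finset.single_le_sum (fun i _ => gibbs_nonneg β t i w) (Finset.mem_univ j)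

theorem continuous_gibbs [Nonempty J] (j : J) : Continuous (gibbs β t j) := by
  unfold gibbs
  exact Continuous.div (by fun_prop) (by fun_prop) fun w => (sum_exp_pos β t w).ne'

theorem hasDerivAt_gibbs [Nonempty J] [DecidableEq ι] (j : J) (k : ι) (w : ι → ℝ) (x : ℝ) :
    HasDerivAt (fun y => gibbs β t j (Function.update w k y))
      (β * gibbs β t j (Function.update w k x) *
        (t j k - ∑ l, gibbs β t l (Function.update w k x) * t l k)) x := by
  have h0 : ∀ l, HasDerivAt (fun y => ∑ i, Function.update w k y i * t l i) (t l k) x := by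
    intro l
    have : ∀ i ∈ Finset.univ, HasDerivAt (fun y => Function.update w k y i * t l i)
        ((if i = k then 1 else 0) * t l i) x := by
      intro i _
      by_cases h : i = k
      · subst h
        simpa using (hasDerivAt_id x).mul_const (t l i)
      · simpa [h] using hasDerivAt_const x (w i * t l i)
    simpa using HasDerivAt.fun_sum this
  have h1 : ∀ l, HasDerivAt (fun y => Real.exp (β * ∑ i, Function.update w k y i * t l i))
      (Real.exp (β * ∑ i, Function.update w k x i * t l i) * (β * t l k)) x :=
    fun l => ((h0 l).const_mul β).exp
  have h2 := (h1 j).div (HasDerivAt.fun_sum fun l (_ : l ∈ Finset.univ) => h1 l)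
    (sum_exp_pos β t (Function.update w k x)).ne'
  convert! h2 using 1
  have hZ := (sum_exp_pos β t (Function.update w k x)).ne'
  simp only [gibbs]
  simp only [div_mul_eq_mul_div, ← Finset.sum_div]
  have : ∑ l, Real.exp (β * ∑ i, Function.update w k x i * t l i) * (β * t l k) =
      β * ∑ l, Real.exp (β * ∑ i, Function.update w k x i * t l i) * t l k := by
    rw [Finset.mul_sum]; exact Finset.sum_congr rfl fun _ _ => by ring
  rw [this]
  field_simp

/-- Gaussian integration by parts: the mean energy of the Gibbs measure is `β` times its expected
variance. -/
theorem integral_gibbs_energy [Nonempty J] :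
    ∫ w, ∑ j, gibbs β t j w * ∑ k, w k * t j k ∂(Measure.pi fun _ : ι => gaussianReal 0 1) =
      ∫ w, β / 2 * ∑ i, ∑ j, gibbs β t i w * gibbs β t j w * ∑ k, (t i k - t j k) ^ 2
        ∂(Measure.pi fun _ : ι => gaussianReal 0 1) := by
  classical
  set μ := Measure.pi fun _ : ι => gaussianReal 0 1 with hμ
  set C : ℝ := 1 + |β| * (2 * ∑ l, ∑ k, |t l k|) with hC
  have hS : 0 ≤ ∑ l, ∑ k, |t l k| := by positivity
  have hle : ∀ l k, |t l k| ≤ ∑ l, ∑ k, |t l k| := fun l k =>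
    (Finset.single_le_sum (f := fun k => |t l k|) (fun _ _ => abs_nonneg _)
      (Finset.mem_univ k)).trans
    (Finset.single_le_sum (f := fun l => ∑ k, |t l k|) (fun _ _ => by positivity)
      (Finset.mem_univ l))
  have habs : ∀ j w, |gibbs β t j w| ≤ 1 := fun j w => by
    rw [abs_of_nonneg (gibbs_nonneg β t j w)]; exact gibbs_le_one β t j w
  have hb : ∀ j w, |gibbs β t j w| ≤ C := fun j w => (habs j w).trans (by
    rw [hC]; have : 0 ≤ |β| * (2 * ∑ l, ∑ k, |t l k|) := by positivity
    linarith)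
  have hb' : ∀ j k w, |β * gibbs β t j w * (t j k - ∑ l, gibbs β t l w * t l k)| ≤ C := by
    intro j k w
    rw [abs_mul, abs_mul]
    have h1 : |t j k - ∑ l, gibbs β t l w * t l k| ≤ 2 * ∑ l, ∑ k, |t l k| := by
      have h2 : |∑ l, gibbs β t l w * t l k| ≤ ∑ l, ∑ k, |t l k| := by
        refine (Finset.abs_sum_le_sum_abs _ _).trans (Finset.sum_le_sum fun l _ => ?_)
        rw [abs_mul]
        calc |gibbs β t l w| * |t l k| ≤ 1 * |t l k| := by gcongr; exact habs l w
          _ ≤ ∑ k, |t l k| := by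
            rw [one_mul]
            exact Finset.single_le_sum (f := fun k => |t l k|) (fun _ _ => abs_nonneg _)
              (Finset.mem_univ k)
      have := (abs_sub (t j k) (∑ l, gibbs β t l w * t l k)).trans (add_le_add (hle j k) h2)
      linarith
    calc |β| * |gibbs β t j w| * |t j k - ∑ l, gibbs β t l w * t l k|
        ≤ |β| * 1 * (2 * ∑ l, ∑ k, |t l k|) := by gcongr; exact habs j w
      _ ≤ C := by rw [hC]; linarith
  have hm : ∀ j, Measurable (gibbs β t j) := fun j => (continuous_gibbs β t j).measurable
  have hm' : ∀ j k, Measurable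
      (fun w => β * gibbs β t j w * (t j k - ∑ l, gibbs β t l w * t l k)) := by
    intro j k; fun_prop
  have hibp : ∀ j k, ∫ w, w k * gibbs β t j w ∂μ =
      ∫ w, β * gibbs β t j w * (t j k - ∑ l, gibbs β t l w * t l k) ∂μ := fun j k =>
    integral_eval_mul_pi_gaussianReal k (hm j) (hm' j k)
      (fun w x => hasDerivAt_gibbs β t j k w x) (hb j) (hb' j k)
  have hi : ∀ k, Integrable (fun w : ι → ℝ => w k) μ := fun k =>
    integrable_eval (μ := fun _ : ι => gaussianReal 0 1) (i := k) IsGaussian.integrable_fun_id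
  have hi1 : ∀ j k, Integrable (fun w : ι → ℝ => w k * gibbs β t j w) μ := fun j k => by
    simpa only [mul_comm] using
      (hi k).bdd_mul (hm j).aestronglyMeasurable (ae_of_all _ (hb j))
  have hi2 : ∀ j k, Integrable
      (fun w => β * gibbs β t j w * (t j k - ∑ l, gibbs β t l w * t l k)) μ := fun j k =>
    Integrable.of_bound (hm' j k).aestronglyMeasurable C (ae_of_all _ (hb' j k))
  have e1 : ∀ w : ι → ℝ, ∑ j, gibbs β t j w * ∑ k, w k * t j k =
      ∑ j, ∑ k, t j k * (w k * gibbs β t j w) := fun w =>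
    Finset.sum_congr rfl fun j _ => by
      rw [Finset.mul_sum]; exact Finset.sum_congr rfl fun k _ => by ring
  simp only [e1]
  rw [integral_finsetSum _ fun j _ => integrable_finsetSum _ fun k _ => (hi1 j k).const_mul _]
  have e2 : ∀ j, ∫ w, ∑ k, t j k * (w k * gibbs β t j w) ∂μ =
      ∫ w, ∑ k, t j k * (β * gibbs β t j w * (t j k - ∑ l, gibbs β t l w * t l k)) ∂μ := by
    intro j
    rw [integral_finsetSum _ fun k _ => (hi1 j k).const_mul _,
      integral_finsetSum _ fun k _ => (hi2 j k).const_mul _]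
    refine Finset.sum_congr rfl fun k _ => ?_
    rw [integral_const_mul, integral_const_mul, hibp]
  simp only [e2]
  rw [← integral_finsetSum _ fun j _ => integrable_finsetSum _ fun k _ => (hi2 j k).const_mul _]
  congr 1
  ext w
  -- the variance of a finite probability vector as a double sum
  have hp := sum_gibbs β t w
  rw [Finset.sum_comm]
  have e3 : ∑ i, ∑ j, gibbs β t i w * gibbs β t j w * ∑ k, (t i k - t j k) ^ 2 =
      ∑ k, ∑ i, ∑ j, gibbs β t i w * gibbs β t j w * (t i k - t j k) ^ 2 := by
    simp only [Finset.mul_sum]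
    rw [Finset.sum_congr rfl fun i _ => Finset.sum_comm, Finset.sum_comm]
  rw [e3, Finset.mul_sum]
  refine Finset.sum_congr rfl fun k _ => ?_
  set m := ∑ l, gibbs β t l w * t l k with hmdef
  set q := ∑ l, gibbs β t l w * t l k ^ 2 with hq
  have l1 : ∑ j, t j k * (β * gibbs β t j w * (t j k - m)) = β * (q - m * m) := by
    have : ∀ j, t j k * (β * gibbs β t j w * (t j k - m)) =
        β * (gibbs β t j w * t j k ^ 2) - β * m * (gibbs β t j w * t j k) := fun j => by ring
    simp only [this, Finset.sum_sub_distrib, ← Finset.mul_sum, ← hmdef, ← hq]; ring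
  have l2 : ∀ i, ∑ j, gibbs β t i w * gibbs β t j w * (t i k - t j k) ^ 2 =
      gibbs β t i w * t i k ^ 2 - 2 * m * (gibbs β t i w * t i k) + q * gibbs β t i w := by
    intro i
    have : ∀ j, gibbs β t i w * gibbs β t j w * (t i k - t j k) ^ 2 =
        gibbs β t i w * t i k ^ 2 * gibbs β t j w
          - 2 * (gibbs β t i w * t i k) * (gibbs β t j w * t j k)
          + gibbs β t i w * (gibbs β t j w * t j k ^ 2) := fun j => by ring
    simp only [this, Finset.sum_sub_distrib, Finset.sum_add_distrib, ← Finset.mul_sum, ← hmdef,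
      ← hq, hp]; ring
  simp only [l2, Finset.sum_sub_distrib, Finset.sum_add_distrib, ← Finset.mul_sum, ← hmdef,
    ← hq, hp, l1]
  ring

/-- The exponential moments of a linear form of independent standard Gaussian variables. -/
theorem integral_exp_linear (v : ι → ℝ) :
    Integrable (fun w => Real.exp (∑ k, w k * v k))
      (Measure.pi fun _ : ι => gaussianReal 0 1) ∧
    ∫ w, Real.exp (∑ k, w k * v k) ∂(Measure.pi fun _ : ι => gaussianReal 0 1) =
      Real.exp ((∑ k, v k ^ 2) / 2) := by
  simp only [Real.exp_sum]
  constructor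
  · refine Integrable.fintype_prod (f := fun k x => Real.exp (x * v k)) fun k => ?_
    simpa [mul_comm] using integrable_exp_mul_gaussianReal (μ := 0) (v := 1) (v k)
  · rw [integral_fintype_prod_eq_prod (f := fun k x => Real.exp (x * v k)), Finset.sum_div,
      Real.exp_sum]
    refine Finset.prod_congr rfl fun k _ => ?_
    have := congrFun (mgf_id_gaussianReal (μ := 0) (v := 1)) (v k)
    simpa [mgf, mul_comm] using this

/-- If the points are at distance at most `D`, then the Gibbs measure on a large number of points is
spread out: the sum of its squared weights is small, uniformly for bounded `β * D`. -/
theorem integral_sum_gibbs_sq_le [Nonempty J] {D : ℝ}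
    (hD : ∀ i j, ∑ k, (t i k - t j k) ^ 2 ≤ D ^ 2) :
    ∫ w, ∑ j, gibbs β t j w ^ 2 ∂(Measure.pi fun _ : ι => gaussianReal 0 1) ≤
      Real.exp (2 * β ^ 2 * D ^ 2) / Fintype.card J := by
  set μ := Measure.pi fun _ : ι => gaussianReal 0 1 with hμ
  have hm : (0 : ℝ) < Fintype.card J := by exact_mod_cast Fintype.card_pos
  -- `p_i = (∑_j e^{β(g_j - g_i)})⁻¹`, and the inverse of a mean is at most the mean of the inverses
  have hp : ∀ i w, gibbs β t i w ^ 2 ≤ (1 / (Fintype.card J : ℝ) ^ 3) *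
      ∑ j, Real.exp (∑ k, w k * (2 * β * (t i k - t j k))) := by
    intro i w
    set a : J → ℝ := fun j => Real.exp (β * ∑ k, w k * t j k) with ha
    have hapos : ∀ j, 0 < a j := fun j => Real.exp_pos _
    have hZ : 0 < ∑ j, a j := sum_exp_pos β t w
    have h1 : (Fintype.card J : ℝ) ^ 2 ≤ (∑ j, a j) * ∑ j, (a j)⁻¹ := by
      have := Finset.sum_mul_sq_le_sq_mul_sq Finset.univ (fun j => √(a j)) (fun j => (√(a j))⁻¹)
      have e : ∀ j, √(a j) * (√(a j))⁻¹ = 1 := fun j =>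
        mul_inv_cancel₀ (Real.sqrt_pos.2 (hapos j)).ne'
      simpa [e, Real.sq_sqrt (hapos _).le] using this
    have h2 : gibbs β t i w ≤ (1 / (Fintype.card J : ℝ) ^ 2) * ∑ j, a i * (a j)⁻¹ := by
      have e : gibbs β t i w = a i / ∑ j, a j := rfl
      rw [e, div_le_iff₀ hZ, ← Finset.mul_sum, one_div]
      have : (1 : ℝ) ≤ ((Fintype.card J : ℝ) ^ 2)⁻¹ * ((∑ j, a j) * ∑ j, (a j)⁻¹) := by
        rw [inv_mul_eq_div, one_le_div (by positivity)]; exact h1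
      calc a i = a i * 1 := by ring
        _ ≤ a i * (((Fintype.card J : ℝ) ^ 2)⁻¹ * ((∑ j, a j) * ∑ j, (a j)⁻¹)) := by
          gcongr
        _ = _ := by ring
    have h3 : (∑ j, a i * (a j)⁻¹) ^ 2 ≤ (Fintype.card J : ℝ) * ∑ j, (a i * (a j)⁻¹) ^ 2 := by
      simpa using sq_sum_le_card_mul_sum_sq (s := Finset.univ) (f := fun j => a i * (a j)⁻¹)
    have h4 : ∀ j, (a i * (a j)⁻¹) ^ 2 = Real.exp (∑ k, w k * (2 * β * (t i k - t j k))) := by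
      intro j
      rw [ha]
      simp only
      rw [← Real.exp_neg, ← Real.exp_add, ← Real.exp_nat_mul]
      congr 1
      push_cast
      rw [Finset.mul_sum, Finset.mul_sum, ← Finset.sum_neg_distrib, ← Finset.sum_add_distrib,
        Finset.mul_sum]
      exact Finset.sum_congr rfl fun k _ => by ring
    simp only [h4] at h3
    calc gibbs β t i w ^ 2 ≤ ((1 / (Fintype.card J : ℝ) ^ 2) * ∑ j, a i * (a j)⁻¹) ^ 2 :=
          pow_le_pow_left₀ (gibbs_nonneg β t i w) h2 2
      _ = (1 / (Fintype.card J : ℝ) ^ 4) * (∑ j, a i * (a j)⁻¹) ^ 2 := by ring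
      _ ≤ (1 / (Fintype.card J : ℝ) ^ 4) * ((Fintype.card J : ℝ) *
          ∑ j, Real.exp (∑ k, w k * (2 * β * (t i k - t j k)))) := by gcongr
      _ = _ := by rw [← mul_assoc]; congr 1; field_simp
  have hint : ∀ i j, Integrable (fun w : ι → ℝ =>
      Real.exp (∑ k, w k * (2 * β * (t i k - t j k)))) μ := fun i j =>
    (integral_exp_linear fun k => 2 * β * (t i k - t j k)).1
  have hval : ∀ i j, ∫ w, Real.exp (∑ k, w k * (2 * β * (t i k - t j k))) ∂μ ≤
      Real.exp (2 * β ^ 2 * D ^ 2) := by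
    intro i j
    rw [hμ, (integral_exp_linear fun k => 2 * β * (t i k - t j k)).2, Real.exp_le_exp]
    have : ∑ k, (2 * β * (t i k - t j k)) ^ 2 = 4 * β ^ 2 * ∑ k, (t i k - t j k) ^ 2 := by
      rw [Finset.mul_sum]; exact Finset.sum_congr rfl fun k _ => by ring
    rw [this]
    nlinarith [hD i j, sq_nonneg β]
  calc ∫ w, ∑ j, gibbs β t j w ^ 2 ∂μ
      ≤ ∫ w, ∑ i, (1 / (Fintype.card J : ℝ) ^ 3) *
          ∑ j, Real.exp (∑ k, w k * (2 * β * (t i k - t j k))) ∂μ := by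
        refine integral_mono_of_nonneg (ae_of_all _ fun w => by positivity) ?_
          (ae_of_all _ fun w => Finset.sum_le_sum fun i _ => hp i w)
        exact integrable_finsetSum _ fun i _ =>
          (integrable_finsetSum _ fun j _ => hint i j).const_mul _
    _ = ∑ i, (1 / (Fintype.card J : ℝ) ^ 3) *
          ∑ j, ∫ w, Real.exp (∑ k, w k * (2 * β * (t i k - t j k))) ∂μ := by
        rw [integral_finsetSum _ fun i _ =>
          (integrable_finsetSum _ fun j _ => hint i j).const_mul _]
        refine Finset.sum_congr rfl fun i _ => ?_
        rw [integral_const_mul, integral_finsetSum _ fun j _ => hint i j]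
    _ ≤ ∑ i : J, (1 / (Fintype.card J : ℝ) ^ 3) * ∑ j : J, Real.exp (2 * β ^ 2 * D ^ 2) := by
        gcongr with i _ j _
        exact hval i j
    _ = _ := by
        simp only [Finset.sum_const, Finset.card_univ, nsmul_eq_mul]
        field_simp

end Gibbs

/-- A lower bound for the expected maximum of a Gaussian process. The maximum is represented by an
arbitrary integrable upper bound `F`, and the process lives on an auxiliary space. The maximum is at
least the mean energy of the Gibbs measure, which is `β` times an expected variance, and this
variance is at least `δ ^ 2 / 2` times the probability that two independent samples differ. -/
theorem le_integral_of_gaussian_le {Y ι J : Type*} [Fintype ι] [Fintype J] [Nonempty J]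
    [MeasurableSpace Y] {ν : Measure Y} {W : Y → ι → ℝ}
    (hW : MeasurePreserving W ν (Measure.pi fun _ : ι => gaussianReal 0 1))
    {F : Y → ℝ} (hF : Integrable F ν) (t : J → ι → ℝ)
    (hle : ∀ j, ∀ᵐ y ∂ν, ∑ k, W y k * t j k ≤ F y) {β δ D : ℝ} (hβ : 0 ≤ β)
    (hδ : ∀ i j, i ≠ j → δ ^ 2 ≤ ∑ k, (t i k - t j k) ^ 2)
    (hD : ∀ i j, ∑ k, (t i k - t j k) ^ 2 ≤ D ^ 2) :
    β / 2 * δ ^ 2 * (1 - Real.exp (2 * β ^ 2 * D ^ 2) / Fintype.card J) ≤ ∫ y, F y ∂ν := by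
  set μ := Measure.pi fun _ : ι => gaussianReal 0 1 with hμ
  have hm : ∀ j, Measurable (gibbs β t j) := fun j => (continuous_gibbs β t j).measurable
  have hi : ∀ k, Integrable (fun w : ι → ℝ => w k) μ := fun k =>
    integrable_eval (μ := fun _ : ι => gaussianReal 0 1) (i := k) IsGaussian.integrable_fun_id
  have habs : ∀ j w, ‖gibbs β t j w‖ ≤ 1 := fun j w => by
    rw [Real.norm_of_nonneg (gibbs_nonneg β t j w)]; exact gibbs_le_one β t j w
  have hE : Integrable (fun w : ι → ℝ => ∑ j, gibbs β t j w * ∑ k, w k * t j k) μ :=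
    integrable_finsetSum _ fun j _ => (integrable_finsetSum _ fun k _ =>
      (hi k).mul_const _).bdd_mul (hm j).aestronglyMeasurable (ae_of_all _ (habs j))
  have h1 : ∫ w, ∑ j, gibbs β t j w * ∑ k, w k * t j k ∂μ ≤ ∫ y, F y ∂ν := by
    rw [← hW.map_eq, integral_map hW.measurable.aemeasurable
      (by rw [hW.map_eq]; exact hE.aestronglyMeasurable)]
    refine integral_mono_ae ?_ hF ?_
    · exact (integrable_map_measure (by rw [hW.map_eq]; exact hE.aestronglyMeasurable)
        hW.measurable.aemeasurable).1 (by rw [hW.map_eq]; exact hE)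
    · have := ae_all_iff.2 hle
      filter_upwards [this] with y hy
      calc ∑ j, gibbs β t j (W y) * ∑ k, W y k * t j k
          ≤ ∑ j, gibbs β t j (W y) * F y := by
            gcongr with j _
            · exact gibbs_nonneg β t j _
            · exact hy j
        _ = F y := by rw [← Finset.sum_mul, sum_gibbs, one_mul]
  refine le_trans ?_ h1
  -- only pairs of distinct points contribute to the variance, each at least `δ ^ 2`
  rw [hμ, integral_gibbs_energy, ← hμ]
  have hsq : Integrable (fun w : ι → ℝ => ∑ j, gibbs β t j w ^ 2) μ := by
    refine integrable_finsetSum _ fun j _ => Integrable.of_bound (by fun_prop) 1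
      (ae_of_all _ fun w => ?_)
    rw [norm_pow]
    exact pow_le_one₀ (norm_nonneg _) (habs j w)
  have hvar : Integrable (fun w : ι → ℝ => β / 2 * ∑ i, ∑ j, gibbs β t i w * gibbs β t j w *
      ∑ k, (t i k - t j k) ^ 2) μ := by
    refine Integrable.const_mul (integrable_finsetSum _ fun i _ => integrable_finsetSum _ fun j _ =>
      Integrable.mul_const ?_ _) _
    refine Integrable.of_bound (by fun_prop) 1 (ae_of_all _ fun w => ?_)
    rw [norm_mul]
    exact mul_le_one₀ (habs i w) (norm_nonneg _) (habs j w)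
  calc β / 2 * δ ^ 2 * (1 - Real.exp (2 * β ^ 2 * D ^ 2) / Fintype.card J)
      ≤ β / 2 * δ ^ 2 * (1 - ∫ w, ∑ j, gibbs β t j w ^ 2 ∂μ) := by
        gcongr
        exact integral_sum_gibbs_sq_le β t hD
    _ = ∫ w, β / 2 * δ ^ 2 * (1 - ∑ j, gibbs β t j w ^ 2) ∂μ := by
        rw [integral_const_mul, integral_sub (integrable_const _) hsq]
        simp
    _ ≤ _ := by
        refine integral_mono (((integrable_const _).sub hsq).const_mul _) hvar fun w => ?_
        simp only
        rw [mul_assoc]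
        gcongr
        have e : 1 - ∑ j, gibbs β t j w ^ 2 =
            ∑ i, ∑ j, gibbs β t i w * gibbs β t j w - ∑ j, gibbs β t j w ^ 2 := by
          simp only [← Finset.mul_sum, sum_gibbs, mul_one]
        rw [e, ← Finset.sum_sub_distrib, Finset.mul_sum]
        refine Finset.sum_le_sum fun i _ => ?_
        classical
        rw [← Finset.add_sum_erase _ _ (Finset.mem_univ i),
          ← Finset.add_sum_erase (f := fun j => gibbs β t i w * gibbs β t j w *
            ∑ k, (t i k - t j k) ^ 2) _ (Finset.mem_univ i)]
        have : δ ^ 2 * (gibbs β t i w * gibbs β t i w +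
            ∑ x ∈ Finset.univ.erase i, gibbs β t i w * gibbs β t x w - gibbs β t i w ^ 2) =
            ∑ x ∈ Finset.univ.erase i, gibbs β t i w * gibbs β t x w * δ ^ 2 := by
          rw [← Finset.sum_mul]; ring
        rw [this]
        have h0 : 0 ≤ gibbs β t i w * gibbs β t i w * ∑ k, (t i k - t i k) ^ 2 :=
          mul_nonneg (mul_nonneg (gibbs_nonneg _ _ _ _) (gibbs_nonneg _ _ _ _)) (by positivity)
        refine le_trans (Finset.sum_le_sum fun j hj => ?_) (le_add_of_nonneg_left h0)
        gcongr
        · exact mul_nonneg (gibbs_nonneg _ _ _ _) (gibbs_nonneg _ _ _ _)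
        · exact hδ i j (Finset.ne_of_mem_erase hj).symm

/-- A number of points that suffices for the soft Sudakov minoration with constant `B`. The exponent
is `2 * β ^ 2 * D ^ 2` for the inverse temperature `β = 8 * B / δ` and the diameter `D = 25 * B * δ`
in the proof of `soft_sudakov`. -/
def sudakovCard (B : ℝ) : ℕ := ⌈2 * Real.exp (2 * (8 * B) ^ 2 * (25 * B) ^ 2)⌉₊

theorem sudakovCard_pos (B : ℝ) : 0 < sudakovCard B := Nat.ceil_pos.2 (by positivity)

/-- A soft form of the Sudakov minoration: the expected maximum of a Gaussian process over a
`δ`-separated set exceeds any given multiple of `δ` as soon as the set is large enough. -/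
theorem soft_sudakov {Y ι : Type*} [Fintype ι] [MeasurableSpace Y] {ν : Measure Y}
    {W : Y → ι → ℝ} (hW : MeasurePreserving W ν (Measure.pi fun _ : ι => gaussianReal 0 1))
    {F : Y → ℝ} (hF : Integrable F ν) {B : ℝ} (hB : 0 < B) (t : Fin (sudakovCard B) → ι → ℝ)
    (hle : ∀ j, ∀ᵐ y ∂ν, ∑ k, W y k * t j k ≤ F y) {δ : ℝ} (hδ : 0 < δ)
    (hsep : ∀ i j, i ≠ j → δ ^ 2 ≤ ∑ k, (t i k - t j k) ^ 2) : B * δ ≤ ∫ y, F y ∂ν := by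
  have hm : 2 * Real.exp (2 * (8 * B) ^ 2 * (25 * B) ^ 2) ≤ sudakovCard B := Nat.le_ceil _
  have hmN := sudakovCard_pos B
  generalize sudakovCard B = m at t hle hsep hm hmN
  have hm0 : (0 : ℝ) < m := by exact_mod_cast hmN
  have : Nonempty (Fin m) := ⟨⟨0, hmN⟩⟩
  by_cases hdiam : ∀ i j, ∑ k, (t i k - t j k) ^ 2 ≤ (25 * B * δ) ^ 2
  · -- small diameter: use all the points, at inverse temperature `8B/δ`
    have h := le_integral_of_gaussian_le hW hF t hle (β := 8 * B / δ) (by positivity) hsep hdiam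
    refine le_trans ?_ h
    have e : 2 * (8 * B / δ) ^ 2 * (25 * B * δ) ^ 2 = 2 * (8 * B) ^ 2 * (25 * B) ^ 2 := by
      field_simp
    rw [e, Fintype.card_fin]
    have h2 : Real.exp (2 * (8 * B) ^ 2 * (25 * B) ^ 2) / m ≤ 1 / 2 := by
      rw [div_le_iff₀ hm0]; linarith
    have e2 : 8 * B / δ / 2 * δ ^ 2 = 4 * B * δ := by field_simp; ring
    rw [e2]
    nlinarith [mul_pos hB hδ]
  · -- large diameter: two far points suffice
    push Not at hdiam
    obtain ⟨i, j, hij⟩ := hdiam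
    set D := √(∑ k, (t i k - t j k) ^ 2) with hDdef
    have hD2 : D ^ 2 = ∑ k, (t i k - t j k) ^ 2 := Real.sq_sqrt (by positivity)
    have hBd : 0 < 25 * B * δ := by positivity
    have hDgt : 25 * B * δ < D := Real.lt_sqrt_of_sq_lt hij
    have hD0 : 0 < D := hBd.trans hDgt
    have hsymm : ∑ k, (t j k - t i k) ^ 2 = D ^ 2 := by
      rw [hD2]; exact Finset.sum_congr rfl fun k _ => by ring
    have h := le_integral_of_gaussian_le hW hF (![t i, t j] : Fin 2 → ι → ℝ)
      (fun l => by fin_cases l <;> simp [hle]) (β := 1 / (2 * D)) (δ := D) (D := D) (by positivity)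
      (fun a b hab => by fin_cases a <;> fin_cases b <;> simp_all)
      (fun a b => by fin_cases a <;> fin_cases b <;> simp [hsymm, ← hD2, sq_nonneg])
    refine le_trans ?_ h
    have e : 2 * (1 / (2 * D)) ^ 2 * D ^ 2 = 1 / 2 := by field_simp
    have e2 : 1 / (2 * D) / 2 * D ^ 2 = D / 4 := by field_simp; norm_num
    have h3 : Real.exp (1 / 2) ≤ 1.65 := by
      have h4 : Real.exp (1 / 2) ^ 2 = Real.exp 1 := by
        rw [← Real.exp_nat_mul]; norm_num
      have h5 := Real.exp_one_lt_d9
      have h6 := Real.exp_pos (1 / 2)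
      nlinarith
    rw [e, e2, Fintype.card_fin]
    push_cast
    nlinarith

/-! ### Absolute continuity of product laws -/

theorem iidLaw_absolutelyContinuous {I α : Type*} [Fintype I] [MeasurableSpace α]
    {μ ν : Measure α} [SigmaFinite μ] [SigmaFinite ν] (h : μ ≪ ν) : iidLaw I μ ≪ iidLaw I ν := by
  have key : ∀ n : ℕ, iidLaw (Fin n) μ ≪ iidLaw (Fin n) ν := by
    intro n
    induction n with
    | zero =>
      simp only [iidLaw]
      rw [Measure.pi_of_empty (fun _ : Fin 0 => μ), Measure.pi_of_empty (fun _ : Fin 0 => ν)]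
    | succ n ih =>
      have e1 := (measurePreserving_piFinSuccAbove (fun _ : Fin (n + 1) => μ) 0).symm
      have e2 := (measurePreserving_piFinSuccAbove (fun _ : Fin (n + 1) => ν) 0).symm
      simp only [iidLaw]
      rw [← e1.map_eq, ← e2.map_eq]
      exact (h.prod ih).map e1.measurable
  have e1 := measurePreserving_piCongrLeft (fun _ : I => μ) (Fintype.equivFin I).symm
  have e2 := measurePreserving_piCongrLeft (fun _ : I => ν) (Fintype.equivFin I).symm
  simp only [iidLaw]
  rw [← e1.map_eq, ← e2.map_eq]
  exact (key _).map e1.measurable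

theorem stdGaussian_absolutelyContinuous (d : ℕ) :
    stdGaussian (Vec d) ≪ (volume : Measure (Vec d)) := by
  rw [← map_pi_eq_stdGaussian, ← (PiLp.volume_preserving_toLp (Fin d)).map_eq, volume_pi]
  exact (iidLaw_absolutelyContinuous (gaussianReal_absolutelyContinuous 0 one_ne_zero)).map
    (by fun_prop)

theorem map_neg_stdGaussian (d : ℕ) :
    (stdGaussian (Vec d)).map (fun w => -w) = stdGaussian (Vec d) :=
  stdGaussian_map (LinearIsometryEquiv.neg ℝ (E := Vec d))

theorem stdGaussian_map_eval {d : ℕ} (a : Fin d) :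
    (stdGaussian (Vec d)).map (fun w => w a) = gaussianReal 0 1 := by
  rw [← map_pi_eq_stdGaussian, Measure.map_map (by fun_prop) (by fun_prop)]
  exact (measurePreserving_eval (fun _ : Fin d => gaussianReal 0 1) a).map_eq

theorem ae_ne_zero_stdGaussian {d : ℕ} (a : Fin d) : ∀ᵐ w ∂(stdGaussian (Vec d)), w a ≠ 0 := by
  have h1 : ∀ᵐ x ∂(gaussianReal 0 1), x ≠ 0 := by
    have h0 : ∀ᵐ x ∂(volume : Measure ℝ), x ≠ 0 := by rw [ae_iff]; simp
    exact (gaussianReal_absolutelyContinuous 0 one_ne_zero).ae_le h0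
  rw [← stdGaussian_map_eval a] at h1
  exact ae_of_ae_map (f := fun w : Vec d => w a) (p := fun x => x ≠ 0) (by fun_prop) h1

/-! ### An exchangeable perturbation of a random vector -/

section Coupling

variable {d : ℕ}

/-- The rejection probability `(1 - f(x + sw)/f(x))₊` of the proposed move from `x` to `x + sw`. It
is `1` where `f x = 0`, which happens with probability zero. -/
def rejProb (f : Vec d → ℝ) (s : ℝ) (z : Vec d × Vec d) : ℝ :=
  max (1 - f (z.1 + s • z.2) / f z.1) 0

theorem rejProb_nonneg (f : Vec d → ℝ) (s : ℝ) (z) : 0 ≤ rejProb f s z := le_max_right _ _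

theorem rejProb_le_one {f : Vec d → ℝ} (hf : ∀ x, 0 ≤ f x) (s : ℝ) (z) : rejProb f s z ≤ 1 :=
  max_le (by have := div_nonneg (hf (z.1 + s • z.2)) (hf z.1); linarith) zero_le_one

theorem measurable_rejProb {f : Vec d → ℝ} (hf : Measurable f) (s : ℝ) :
    Measurable (rejProb f s) := by
  unfold rejProb
  have : Measurable fun z : Vec d × Vec d => f (z.1 + s • z.2) := hf.comp (by fun_prop)
  fun_prop

/-- The countably many cells into which rejected moves are sorted. -/
abbrev Cell (d : ℕ) : Type := Fin d → ℕ × ℤ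

/-- The cell of a pair `(x, w)`: for each coordinate an upper bound `n` of `1/|w|` and the index of
the interval of length `s/n` containing `x`. Two points `x`, `x'` of a common cell satisfy
`|x' - x| ≤ s |w|` in every coordinate. -/
def cell (s : ℝ) (z : Vec d × Vec d) : Cell d := fun a =>
  (⌈1 / |z.2 a|⌉₊, ⌊z.1 a * (⌈1 / |z.2 a|⌉₊ : ℝ) / s⌋)

theorem measurable_cell (s : ℝ) : Measurable (cell (d := d) s) := by
  rw [measurable_pi_iff]
  intro a
  have h1 : Measurable fun z : Vec d × Vec d => ⌈1 / |z.2 a|⌉₊ :=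
    Nat.measurable_ceil.comp (by fun_prop)
  have h2 : Measurable fun z : Vec d × Vec d => (⌈1 / |z.2 a|⌉₊ : ℝ) :=
    measurable_from_top.comp h1
  exact h1.prodMk (Int.measurable_floor.comp (by fun_prop))

theorem abs_sub_le_of_cell_eq {s : ℝ} (hs : 0 < s) {z z' : Vec d × Vec d}
    (h : cell s z = cell s z') {a : Fin d} (ha : z.2 a ≠ 0) : |z'.1 a - z.1 a| ≤ s * |z.2 a| := by
  have h1 := congrFun h a
  simp only [cell, Prod.mk.injEq] at h1
  obtain ⟨h1, h2⟩ := h1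
  rw [← h1] at h2
  set n := ⌈1 / |z.2 a|⌉₊ with hn
  have hw : 0 < |z.2 a| := abs_pos.2 ha
  have hn1 : 1 / |z.2 a| ≤ n := Nat.le_ceil _
  have hn0 : (0 : ℝ) < n := lt_of_lt_of_le (by positivity) hn1
  have h3 := Int.abs_sub_lt_one_of_floor_eq_floor h2
  rw [← sub_div, ← sub_mul, abs_div, abs_mul, abs_of_pos hs, abs_of_pos hn0,
    div_lt_one hs, abs_sub_comm] at h3
  have h4 : 1 ≤ n * |z.2 a| := by rwa [div_le_iff₀ hw] at hn1
  have h5 : |z'.1 a - z.1 a| * n ≤ (s * |z.2 a|) * n := by nlinarith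
  exact le_of_mul_le_mul_right h5 hn0

/-- The auxiliary randomness: a uniform variable, deciding on acceptance, and for each cell a
point which replaces a rejected move. -/
abbrev Noise (d : ℕ) : Type := unitInterval × (Cell d → Vec d)

/-- The law of the noise, with independent components, for given laws `η c` of the replacement
points. -/
def noiseLaw (η : Cell d → Measure (Vec d)) : Measure (Noise d) :=
  (volume : Measure unitInterval).prod (Measure.infinitePi η)

instance (η : Cell d → Measure (Vec d)) [∀ c, IsProbabilityMeasure (η c)] :
    IsProbabilityMeasure (noiseLaw η) := by unfold noiseLaw; infer_instance

/-- The perturbation of `x`, in units of `s`: the proposed `w` if it is accepted, and otherwise the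
displacement that leads to the replacement point of the cell of `(x, w)`. -/
def move (f : Vec d → ℝ) (s : ℝ) (z : Vec d × Vec d × Noise d) : Vec d :=
  if (z.2.2.1 : ℝ) ≤ 1 - rejProb f s (z.1, z.2.1) then z.2.1
  else s⁻¹ • (z.2.2.2 (cell s (z.1, z.2.1)) - z.1)

theorem measurable_move {f : Vec d → ℝ} (hf : Measurable f) (s : ℝ) : Measurable (move f s) := by
  have hr : Measurable fun z : Vec d × Vec d × Noise d => rejProb f s (z.1, z.2.1) :=
    (measurable_rejProb hf s).comp (by fun_prop)
  have hv : Measurable fun z : Vec d × Vec d × Noise d => z.2.2.2 (cell s (z.1, z.2.1)) := by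
    have h1 : Measurable fun p : (Cell d → Vec d) × Cell d => p.1 p.2 :=
      measurable_from_prod_countable_left fun y => measurable_pi_apply y
    have h2 : Measurable fun z : Vec d × Vec d × Noise d => cell s (z.1, z.2.1) :=
      (measurable_cell s).comp (by fun_prop)
    exact h1.comp (Measurable.prodMk (by fun_prop) h2)
  unfold move
  refine Measurable.ite (measurableSet_le (by fun_prop) (by fun_prop)) (by fun_prop) (by fun_prop)

/-- The law of the perturbation as a mixture of accepted and rejected moves. -/
theorem lintegral_move {f : Vec d → ℝ} (hf : Measurable f) (hf0 : ∀ x, 0 ≤ f x) (s : ℝ)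
    (P : Measure (Vec d)) [IsProbabilityMeasure P]
    (η : Cell d → Measure (Vec d)) [∀ c, IsProbabilityMeasure (η c)]
    {G : (Vec d × Vec d) × Vec d → ℝ≥0∞} (hG : Measurable G) :
    ∫⁻ z, G ((z.1, z.2.1), move f s z)
        ∂(P.prod ((stdGaussian (Vec d)).prod (noiseLaw η))) =
      ∫⁻ z, ENNReal.ofReal (1 - rejProb f s z) * G (z, z.2) ∂(P.prod (stdGaussian (Vec d))) +
      ∫⁻ z, ENNReal.ofReal (rejProb f s z) * ∫⁻ y, G (z, s⁻¹ • (y - z.1)) ∂(η (cell s z))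
        ∂(P.prod (stdGaussian (Vec d))) := by
  have hm := measurable_move hf s
  have hrm := measurable_rejProb hf s
  have hGm : Measurable fun z : Vec d × Vec d × Noise d => G ((z.1, z.2.1), move f s z) :=
    hG.comp (by fun_prop)
  have hGm2 : Measurable fun a : (Vec d × Vec d) × Noise d =>
      G (((MeasurableEquiv.prodAssoc a).1, (MeasurableEquiv.prodAssoc a).2.1),
        move f s (MeasurableEquiv.prodAssoc a)) := hGm.comp MeasurableEquiv.prodAssoc.measurable
  rw [← (measurePreserving_prodAssoc P (stdGaussian (Vec d)) (noiseLaw η)).lintegral_comp hGm,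
    lintegral_prod _ hGm2.aemeasurable, ← lintegral_add_left (by fun_prop)]
  refine lintegral_congr fun z => ?_
  set c : unitInterval := ⟨1 - rejProb f s z, by
    have h1 := rejProb_nonneg f s z
    have h2 := rejProb_le_one hf0 s z
    constructor <;> linarith⟩ with hc
  rw [noiseLaw, lintegral_prod]
  · have h1 : ∀ u : unitInterval, ∫⁻ v, G ((z.1, z.2), move f s (z.1, z.2, u, v))
        ∂(Measure.infinitePi η) = (Set.Iic c).indicator (fun _ => G (z, z.2)) u +
        (Set.Ioi c).indicator (fun _ => ∫⁻ y, G (z, s⁻¹ • (y - z.1)) ∂(η (cell s z))) u := by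
      intro u
      by_cases hu : u ≤ c
      · have hu' : (u : ℝ) ≤ 1 - rejProb f s z := hu
        simp [move, hu, hu']
      · have hu' : ¬ (u : ℝ) ≤ 1 - rejProb f s z := hu
        have hlt := not_le.1 hu
        simp only [move, hu', if_false]
        rw [Set.indicator_of_notMem (by simpa using hlt), Set.indicator_of_mem (by simpa using hlt),
          zero_add, ← (measurePreserving_eval_infinitePi η (cell s z)).lintegral_comp
            (f := fun y => G (z, s⁻¹ • (y - z.1))) (hG.comp (by fun_prop))]
    refine (lintegral_congr h1).trans ?_
    rw [lintegral_add_left (measurable_const.indicator measurableSet_Iic),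
      lintegral_indicator measurableSet_Iic, lintegral_indicator measurableSet_Ioi,
      setLIntegral_const, setLIntegral_const, unitInterval.volume_Iic, unitInterval.volume_Ioi]
    simp [hc, mul_comm]
  · exact (hGm.comp ((MeasurableEquiv.prodAssoc (α := Vec d) (β := Vec d)
      (γ := Noise d)).measurable.comp measurable_prodMk_left)).aemeasurable

/-- The law of the rejected pairs `(x, w)`, a sub-probability measure. -/
def rejLaw (f : Vec d → ℝ) (s : ℝ) (P : Measure (Vec d)) : Measure (Vec d × Vec d) :=
  (P.prod (stdGaussian (Vec d))).withDensity fun z => ENNReal.ofReal (rejProb f s z)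

instance (f : Vec d → ℝ) (s : ℝ) (P : Measure (Vec d)) [IsProbabilityMeasure P] :
    SFinite (rejLaw f s P) := by unfold rejLaw; infer_instance

theorem rejLaw_le {f : Vec d → ℝ} (hf0 : ∀ x, 0 ≤ f x) (s : ℝ) (P : Measure (Vec d)) :
    rejLaw f s P ≤ P.prod (stdGaussian (Vec d)) := by
  conv_rhs => rw [← withDensity_one (μ := P.prod (stdGaussian (Vec d)))]
  refine withDensity_mono (ae_of_all _ fun z => ?_)
  simpa using ENNReal.ofReal_le_ofReal (rejProb_le_one hf0 s z)

/-- The pairs in a given cell. -/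
def cellSet (s : ℝ) (c : Cell d) : Set (Vec d × Vec d) := cell s ⁻¹' {c}

theorem measurableSet_cellSet (s : ℝ) (c : Cell d) : MeasurableSet (cellSet s c) :=
  measurable_cell s (measurableSet_singleton c)

/-- The law of `x` among the rejected pairs of a given cell (an arbitrary probability measure if
there are none). -/
def resampleLaw (f : Vec d → ℝ) (s : ℝ) (P : Measure (Vec d)) (c : Cell d) : Measure (Vec d) :=
  open Classical in
  if rejLaw f s P (cellSet s c) = 0 then Measure.dirac 0
  else ((rejLaw f s P)[|cellSet s c]).map Prod.fst

theorem isProbabilityMeasure_resampleLaw {f : Vec d → ℝ} (hf0 : ∀ x, 0 ≤ f x) (s : ℝ)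
    (P : Measure (Vec d)) [IsProbabilityMeasure P] (c : Cell d) :
    IsProbabilityMeasure (resampleLaw f s P c) := by
  unfold resampleLaw
  split_ifs with h
  · infer_instance
  · have : IsFiniteMeasure (rejLaw f s P) := isFiniteMeasure_of_le _ (rejLaw_le hf0 s P)
    have := cond_isProbabilityMeasure h
    exact Measure.isProbabilityMeasure_map (by fun_prop)

theorem measurable_lintegral_countable {α β κ : Type*} [MeasurableSpace α] [MeasurableSpace β]
    [MeasurableSpace κ] [Countable κ] [MeasurableSingletonClass κ] (η : κ → Measure β)
    [∀ c, SFinite (η c)] {G : α × β → ℝ≥0∞} (hG : Measurable G) :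
    Measurable fun p : α × κ => ∫⁻ y, G (p.1, y) ∂(η p.2) := by
  refine measurable_from_prod_countable_left fun c => ?_
  have := ‹∀ c, SFinite (η c)› c
  exact hG.lintegral_prod_right' (ν := η c)

/-- The law of the rejected moves as a mixture over the cells. -/
theorem lintegral_rejected {f : Vec d → ℝ} (hf : Measurable f) (hf0 : ∀ x, 0 ≤ f x) (s : ℝ)
    (P : Measure (Vec d)) [IsProbabilityMeasure P]
    {G : (Vec d × Vec d) × Vec d → ℝ≥0∞} (hG : Measurable G) :
    ∫⁻ z, ENNReal.ofReal (rejProb f s z) * ∫⁻ y, G (z, y) ∂(resampleLaw f s P (cell s z))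
        ∂(P.prod (stdGaussian (Vec d))) =
      ∑' c, rejLaw f s P (cellSet s c) *
        ∫⁻ z, ∫⁻ y, G (z, y) ∂(resampleLaw f s P c) ∂((rejLaw f s P)[|cellSet s c]) := by
  have hp := isProbabilityMeasure_resampleLaw (f := f) hf0 s P
  have hGc : Measurable fun z : Vec d × Vec d =>
      ∫⁻ y, G (z, y) ∂(resampleLaw f s P (cell s z)) := by
    have h1 := measurable_lintegral_countable (resampleLaw f s P) hG
    generalize resampleLaw f s P = η at h1 ⊢
    have h2 : Measurable fun z : Vec d × Vec d => (z, cell s z) :=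
      measurable_id.prodMk (measurable_cell s)
    exact h1.comp h2
  have hfin : IsFiniteMeasure (rejLaw f s P) := isFiniteMeasure_of_le _ (rejLaw_le hf0 s P)
  have h2 : ∫⁻ z, ENNReal.ofReal (rejProb f s z) *
        ∫⁻ y, G (z, y) ∂(resampleLaw f s P (cell s z)) ∂(P.prod (stdGaussian (Vec d))) =
      ∫⁻ z, ∫⁻ y, G (z, y) ∂(resampleLaw f s P (cell s z)) ∂(rejLaw f s P) := by
    rw [rejLaw,
      lintegral_withDensity_eq_lintegral_mul _ (measurable_rejProb hf s).ennreal_ofReal hGc]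
    rfl
  have huniv : (⋃ c, cellSet (d := d) s c) = Set.univ := by
    ext z; simp [cellSet]
  rw [h2, ← setLIntegral_univ, ← huniv, lintegral_iUnion (measurableSet_cellSet s)]
  · refine tsum_congr fun c => ?_
    have h3 : ∫⁻ z in cellSet s c, ∫⁻ y, G (z, y) ∂(resampleLaw f s P (cell s z)) ∂(rejLaw f s P) =
        ∫⁻ z in cellSet s c, ∫⁻ y, G (z, y) ∂(resampleLaw f s P c) ∂(rejLaw f s P) := by
      refine setLIntegral_congr_fun (measurableSet_cellSet s c) fun z hz => ?_
      have : cell s z = c := hz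
      simp only [this]
    rw [h3]
    by_cases h0 : rejLaw f s P (cellSet s c) = 0
    · rw [h0, zero_mul, setLIntegral_measure_zero _ _ h0]
    · rw [ProbabilityTheory.cond, lintegral_smul_measure, smul_eq_mul, ← mul_assoc,
        ENNReal.mul_inv_cancel h0 (measure_ne_top _ _), one_mul]
  · intro c c' hcc
    refine Set.disjoint_left.2 fun z hz hz' => hcc ?_
    exact (show cell s z = c from hz).symm.trans hz'

/-- Given the cell, the start and the end of a rejected move are independent with the same law. -/
theorem lintegral_rejected_fst {f : Vec d → ℝ} (hf : Measurable f) (hf0 : ∀ x, 0 ≤ f x) (s : ℝ)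
    (P : Measure (Vec d)) [IsProbabilityMeasure P]
    {F : Vec d × Vec d → ℝ≥0∞} (hF : Measurable F) :
    ∫⁻ z, ENNReal.ofReal (rejProb f s z) * ∫⁻ y, F (z.1, y) ∂(resampleLaw f s P (cell s z))
        ∂(P.prod (stdGaussian (Vec d))) =
      ∑' c, rejLaw f s P (cellSet s c) *
        ∫⁻ x, ∫⁻ y, F (x, y) ∂(resampleLaw f s P c) ∂(resampleLaw f s P c) := by
  have hp := isProbabilityMeasure_resampleLaw (f := f) hf0 s P
  rw [lintegral_rejected hf hf0 s P (G := fun q => F (q.1.1, q.2)) (hF.comp (by fun_prop))]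
  refine tsum_congr fun c => ?_
  by_cases h0 : rejLaw f s P (cellSet s c) = 0
  · simp [h0]
  · congr 1
    conv_rhs => rw [resampleLaw, if_neg h0]
    rw [lintegral_map hF.lintegral_prod_right' (by fun_prop)]
    conv_lhs => simp only [resampleLaw, if_neg h0]

theorem resampleLaw_absolutelyContinuous {f : Vec d → ℝ} (hf0 : ∀ x, 0 ≤ f x) (s : ℝ)
    (P : Measure (Vec d)) [IsProbabilityMeasure P] (hP : P ≪ volume) {c : Cell d}
    (h0 : rejLaw f s P (cellSet s c) ≠ 0) : resampleLaw f s P c ≪ volume := by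
  rw [resampleLaw, if_neg h0]
  have h1 : (rejLaw f s P)[|cellSet s c] ≪ P.prod (stdGaussian (Vec d)) :=
    cond_absolutelyContinuous.trans (rejLaw_le hf0 s P).absolutelyContinuous
  refine (h1.map measurable_fst).trans ?_
  rw [Measure.map_fst_prod]
  simpa using hP

/-- The acceptance part of the move is reversible: detailed balance. -/
theorem lintegral_accepted_symm {f : Vec d → ℝ} (hf : Measurable f) (hf0 : ∀ x, 0 ≤ f x) (s : ℝ)
    {P : Measure (Vec d)} (hP : P = volume.withDensity (fun x => ENNReal.ofReal (f x)))
    [IsProbabilityMeasure P] {F : Vec d × Vec d → ℝ≥0∞} (hF : Measurable F) :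
    ∫⁻ z, ENNReal.ofReal (1 - rejProb f s z) * F (z.1, z.1 + s • z.2)
        ∂(P.prod (stdGaussian (Vec d))) =
      ∫⁻ z, ENNReal.ofReal (1 - rejProb f s z) * F (z.1 + s • z.2, z.1)
        ∂(P.prod (stdGaussian (Vec d))) := by
  have hrm := measurable_rejProb hf s
  -- the accepted proposals have density `min (f x) (f (x + sw))`
  have key : ∀ {G : Vec d × Vec d → ℝ≥0∞}, Measurable G →
      ∫⁻ z, ENNReal.ofReal (1 - rejProb f s z) * G z ∂(P.prod (stdGaussian (Vec d))) =
      ∫⁻ w, ∫⁻ x, ENNReal.ofReal (min (f x) (f (x + s • w))) * G (x, w)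
        ∂(volume : Measure (Vec d)) ∂(stdGaussian (Vec d)) := by
    intro G hG
    have hm : Measurable fun z : Vec d × Vec d => ENNReal.ofReal (1 - rejProb f s z) * G z := by
      fun_prop
    rw [lintegral_prod_symm' _ hm]
    refine lintegral_congr fun w => ?_
    have hm2 : Measurable fun x => ENNReal.ofReal (1 - rejProb f s (x, w)) * G (x, w) :=
      hm.comp measurable_prodMk_right
    rw [hP, lintegral_withDensity_eq_lintegral_mul _ hf.ennreal_ofReal hm2]
    refine lintegral_congr fun x => ?_
    simp only [Pi.mul_apply]
    rw [← mul_assoc, ← ENNReal.ofReal_mul (hf0 x)]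
    congr 2
    simp only [rejProb]
    rcases (hf0 x).eq_or_lt with h | h
    · rw [← h]; simp [hf0]
    · rcases le_total (f (x + s • w)) (f x) with h2 | h2
      · rw [max_eq_left (by rw [sub_nonneg, div_le_one h]; exact h2), min_eq_right h2]
        field_simp; ring
      · rw [max_eq_right (by rw [sub_nonpos, one_le_div h]; exact h2), min_eq_left h2]
        ring
  have hF1 : Measurable fun z : Vec d × Vec d => F (z.1, z.1 + s • z.2) := hF.comp (by fun_prop)
  have hF2 : Measurable fun z : Vec d × Vec d => F (z.1 + s • z.2, z.1) := hF.comp (by fun_prop)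
  rw [key hF1, key hF2]
  have hK : Measurable fun w : Vec d => ∫⁻ x, ENNReal.ofReal (min (f x) (f (x + s • w))) *
      F (x, x + s • w) ∂(volume : Measure (Vec d)) := by
    have h1 : Measurable fun p : Vec d × Vec d => f p.2 := hf.comp (by fun_prop)
    have h2 : Measurable fun p : Vec d × Vec d => f (p.2 + s • p.1) := hf.comp (by fun_prop)
    have h3 : Measurable fun p : Vec d × Vec d => F (p.2, p.2 + s • p.1) := hF.comp (by fun_prop)
    exact Measurable.lintegral_prod_right' (f := fun p : Vec d × Vec d =>
      ENNReal.ofReal (min (f p.2) (f (p.2 + s • p.1))) * F (p.2, p.2 + s • p.1)) (by fun_prop)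
  -- exchange the two ends of the move: `w` becomes `-w`, and `x` becomes `x + sw`
  have hneg := lintegral_map hK (measurable_neg (G := Vec d)) (μ := stdGaussian (Vec d))
  rw [show Neg.neg = fun w : Vec d => -w from rfl, map_neg_stdGaussian] at hneg
  rw [hneg]
  refine lintegral_congr fun w => ?_
  rw [← lintegral_add_right_eq_self _ (s • w)]
  refine lintegral_congr fun x => ?_
  simp [min_comm]

end Coupling

/-- `V` is a perturbation, depending on `x ∼ P`, on a Gaussian proposal `w` and on an independent
noise with law `ν`, such that the pair `(x, x + sV)` is exchangeable with absolutely continuous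
law, `V` is dominated by `w` in every coordinate, and `V` differs from `w` at most with the
rejection probability. -/
structure IsReversibleMove {d : ℕ} (f : Vec d → ℝ) (s : ℝ) (P : Measure (Vec d))
    {N : Type*} [MeasurableSpace N] (ν : Measure N) (V : Vec d × Vec d × N → Vec d) : Prop where
  measurable : Measurable V
  map_symm : (P.prod ((stdGaussian (Vec d)).prod ν)).map (fun z => (z.1, z.1 + s • V z)) =
    (P.prod ((stdGaussian (Vec d)).prod ν)).map (fun z => (z.1 + s • V z, z.1))
  map_absolutelyContinuous :
    (P.prod ((stdGaussian (Vec d)).prod ν)).map (fun z => (z.1, s • V z)) ≪ volume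
  ae_abs_le : ∀ᵐ z ∂(P.prod ((stdGaussian (Vec d)).prod ν)), ∀ a, |V z a| ≤ |z.2.1 a|
  lintegral_rejected_le : ∀ g : Vec d → ℝ≥0∞, Measurable g →
    ∫⁻ z, {z | V z ≠ z.2.1}.indicator (fun z => g z.2.1) z
        ∂(P.prod ((stdGaussian (Vec d)).prod ν)) ≤
      ∫⁻ z, ENNReal.ofReal (rejProb f s z) * g z.2 ∂(P.prod (stdGaussian (Vec d)))

theorem IsReversibleMove.ae_norm_le {d : ℕ} {f : Vec d → ℝ} {s : ℝ} {P : Measure (Vec d)}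
    {N : Type*} [MeasurableSpace N] {ν : Measure N} {V : Vec d × Vec d × N → Vec d}
    (hV : IsReversibleMove f s P ν V) :
    ∀ᵐ z ∂(P.prod ((stdGaussian (Vec d)).prod ν)), ‖V z‖ ≤ ‖z.2.1‖ := by
  filter_upwards [hV.ae_abs_le] with z hz
  rw [EuclideanSpace.norm_eq, EuclideanSpace.norm_eq]
  refine Real.sqrt_le_sqrt (Finset.sum_le_sum fun b _ => ?_)
  exact pow_le_pow_left₀ (norm_nonneg _) (hz b) 2

/-- A Metropolis step whose rejected moves are resampled. Staying put after a rejection would give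
an atom at the zero displacement, for which an expansion off a Lebesgue null set says nothing.
Instead, a rejected move leads to an independent copy of `x` given rejection and the cell of
`(x, w)`. This preserves exchangeability, has a density, and the cells are so small that the
displacement remains dominated by that of the proposal. -/
theorem isReversibleMove_move {d : ℕ} {f : Vec d → ℝ} (hf : Measurable f) (hf0 : ∀ x, 0 ≤ f x)
    {s : ℝ} (hs : 0 < s) {P : Measure (Vec d)}
    (hP : P = volume.withDensity (fun x => ENNReal.ofReal (f x))) [IsProbabilityMeasure P] :
    IsReversibleMove f s P (noiseLaw (resampleLaw f s P)) (move f s) := by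
  have hp := isProbabilityMeasure_resampleLaw (f := f) hf0 s P
  have hm := measurable_move hf s
  have hPac : P ≪ volume := hP ▸ withDensity_absolutelyContinuous _ _
  have hPG : P.prod (stdGaussian (Vec d)) ≪ (volume : Measure (Vec d × Vec d)) :=
    hPac.prod (stdGaussian_absolutelyContinuous d)
  have hfin : IsFiniteMeasure (rejLaw f s P) := isFiniteMeasure_of_le _ (rejLaw_le hf0 s P)
  refine ⟨hm, ?_, ?_, ?_, ?_⟩
  · -- detailed balance for accepted moves, conditional independence for rejected ones
    have key : ∀ F : Vec d × Vec d → ℝ≥0∞, Measurable F →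
        ∫⁻ z, F (z.1, z.1 + s • move f s z)
          ∂(P.prod ((stdGaussian (Vec d)).prod (noiseLaw (resampleLaw f s P)))) =
        ∫⁻ z, F (z.1 + s • move f s z, z.1)
          ∂(P.prod ((stdGaussian (Vec d)).prod (noiseLaw (resampleLaw f s P)))) := by
      intro F hF
      have h1 := lintegral_move hf hf0 s P (resampleLaw f s P)
        (G := fun q => F (q.1.1, q.1.1 + s • q.2)) (hF.comp (by fun_prop))
      have h2 := lintegral_move hf hf0 s P (resampleLaw f s P)
        (G := fun q => F (q.1.1 + s • q.2, q.1.1)) (hF.comp (by fun_prop))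
      simp only [smul_inv_smul₀ hs.ne', add_sub_cancel] at h1 h2
      rw [h1, h2, lintegral_accepted_symm hf hf0 s hP hF,
        lintegral_rejected_fst hf hf0 s P hF,
        lintegral_rejected_fst hf hf0 s P (F := fun q => F (q.2, q.1)) (hF.comp measurable_swap)]
      congr 1
      refine tsum_congr fun c => ?_
      congr 1
      exact lintegral_lintegral_swap hF.aemeasurable
    ext A hA
    rw [Measure.map_apply (by fun_prop) hA, Measure.map_apply (by fun_prop) hA]
    have := key (A.indicator 1) (measurable_one.indicator hA)
    rw [← lintegral_indicator_one, ← lintegral_indicator_one]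
    · exact this
    · exact (by fun_prop : Measurable fun z : Vec d × Vec d × Noise d =>
        (z.1 + s • move f s z, z.1)) hA
    · exact (by fun_prop : Measurable fun z : Vec d × Vec d × Noise d =>
        (z.1, z.1 + s • move f s z)) hA
  · -- the ends of a rejected move are independent given the cell, hence jointly have a density
    refine Measure.AbsolutelyContinuous.mk fun A hA hA0 => ?_
    have hmm : Measurable fun z : Vec d × Vec d × Noise d => (z.1, s • move f s z) := by fun_prop
    rw [Measure.map_apply hmm hA, ← lintegral_indicator_one (hmm hA)]
    have h1 := lintegral_move hf hf0 s P (resampleLaw f s P)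
        (G := fun q => A.indicator 1 (q.1.1, s • q.2))
        ((measurable_one.indicator hA).comp (by fun_prop))
    refine (Eq.trans rfl h1).trans ?_
    simp only [smul_inv_smul₀ hs.ne']
    have e2 : ∫⁻ z, ENNReal.ofReal (rejProb f s z) *
        ∫⁻ y, A.indicator (1 : Vec d × Vec d → ℝ≥0∞) (z.1, y - z.1)
          ∂(resampleLaw f s P (cell s z)) ∂(P.prod (stdGaussian (Vec d))) = 0 := by
      rw [lintegral_rejected_fst hf hf0 s P (F := fun q => A.indicator 1 (q.1, q.2 - q.1))
        ((measurable_one.indicator hA).comp (by fun_prop)), ENNReal.tsum_eq_zero]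
      intro c
      by_cases h0 : rejLaw f s P (cellSet s c) = 0
      · simp [h0]
      have hac := resampleLaw_absolutelyContinuous hf0 s P hPac h0
      have hac2 : (resampleLaw f s P c).prod (resampleLaw f s P c) ≪
          (volume : Measure (Vec d × Vec d)) := hac.prod hac
      have hpres := measurePreserving_prod_neg_add (volume : Measure (Vec d))
        (volume : Measure (Vec d))
      have hnull : (volume : Measure (Vec d × Vec d))
          ((fun q : Vec d × Vec d => (q.1, -q.1 + q.2)) ⁻¹' A) = 0 := by
        rw [Measure.volume_eq_prod, hpres.measure_preimage hA.nullMeasurableSet]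
        exact hA0
      have hz := hac2 hnull
      have hmz : MeasurableSet ((fun q : Vec d × Vec d => (q.1, -q.1 + q.2)) ⁻¹' A) :=
        hpres.measurable hA
      rw [← lintegral_indicator_one hmz, lintegral_prod _
        (measurable_one.indicator hmz).aemeasurable] at hz
      refine mul_eq_zero_of_right _ (Eq.trans ?_ hz)
      refine lintegral_congr fun x => lintegral_congr fun y => ?_
      simp only [Set.indicator, Set.mem_preimage]
      rw [sub_eq_neg_add]; rfl
    rw [e2, add_zero]
    have hq : Measure.QuasiMeasurePreserving (fun q : Vec d × Vec d => (q.1, s • q.2))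
        volume volume := by
      refine ⟨by fun_prop, ?_⟩
      have h4 : (volume : Measure (Vec d)).map (fun w => s • w) ≪ volume := by
        refine Measure.AbsolutelyContinuous.mk fun B hB hB0 => ?_
        rw [Measure.map_apply (by fun_prop) hB, Measure.addHaar_preimage_smul _ hs.ne', hB0,
          mul_zero]
      have h5 := Measure.map_prod_map (volume : Measure (Vec d)) (volume : Measure (Vec d))
        measurable_id (by fun_prop : Measurable fun w : Vec d => s • w)
      have h6 : ((volume : Measure (Vec d)).map id).prod ((volume : Measure (Vec d)).map
          fun w => s • w) ≪ (volume : Measure (Vec d)).prod volume := by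
        rw [Measure.map_id]
        exact (Measure.AbsolutelyContinuous.refl _).prod h4
      rw [h5] at h6
      exact h6
    have h3 : ∀ᵐ z ∂(P.prod (stdGaussian (Vec d))), (z.1, s • z.2) ∉ A := by
      rw [ae_iff]
      simp only [not_not]
      exact hPG (hq.preimage_null hA0)
    rw [lintegral_eq_zero_iff' (by
      refine Measurable.aemeasurable ?_
      have := measurable_rejProb hf s
      have h4 : Measurable fun z : Vec d × Vec d =>
        A.indicator (1 : Vec d × Vec d → ℝ≥0∞) (z.1, s • z.2) :=
          (measurable_one.indicator hA).comp (by fun_prop)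
      fun_prop)]
    filter_upwards [h3] with z hz
    simp [hz]
  · -- both ends of a rejected move belong to the same cell
    set B : Set ((Vec d × Vec d) × Vec d) := {q | ∃ a, |q.1.2 a| < |q.2 a|} with hB
    have hBm : MeasurableSet B := by
      have : B = ⋃ a, {q | |q.1.2 a| < |q.2 a|} := by ext; simp [hB]
      rw [this]
      exact MeasurableSet.iUnion fun a => measurableSet_lt (by fun_prop) (by fun_prop)
    have h1 := lintegral_move hf hf0 s P (resampleLaw f s P) (G := B.indicator 1)
        (measurable_one.indicator hBm)
    have h2 : ∀ᵐ z ∂(P.prod ((stdGaussian (Vec d)).prod (noiseLaw (resampleLaw f s P)))),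
        ((z.1, z.2.1), move f s z) ∉ B := by
      have hmm : Measurable fun z : Vec d × Vec d × Noise d => ((z.1, z.2.1), move f s z) := by
        fun_prop
      rw [ae_iff]
      simp only [not_not]
      refine Eq.trans ?_ (h1.trans ?_)
      · exact (lintegral_indicator_one (hmm hBm)).symm
      · have e1 : ∀ z : Vec d × Vec d,
            B.indicator (1 : (Vec d × Vec d) × Vec d → ℝ≥0∞) (z, z.2) = 0 := fun z => by
          simp [hB]
        simp only [e1, mul_zero, lintegral_zero, zero_add]
        rw [lintegral_rejected hf hf0 s P (G := fun q => B.indicator 1 (q.1, s⁻¹ • (q.2 - q.1.1)))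
          ((measurable_one.indicator hBm).comp (by fun_prop)), ENNReal.tsum_eq_zero]
        intro c
        by_cases h0 : rejLaw f s P (cellSet s c) = 0
        · simp [h0]
        refine mul_eq_zero_of_right _ ?_
        have hM := cond_isProbabilityMeasure h0
        have hcs : ∀ᵐ z ∂((rejLaw f s P)[|cellSet s c]), cell s z = c :=
          ae_cond_mem (measurableSet_cellSet s c)
        have hne : ∀ᵐ z ∂((rejLaw f s P)[|cellSet s c]), ∀ a, z.2 a ≠ 0 := by
          refine (cond_absolutelyContinuous.trans
            (rejLaw_le hf0 s P).absolutelyContinuous).ae_le (ae_all_iff.2 fun a => ?_)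
          exact Measure.quasiMeasurePreserving_snd.ae (ae_ne_zero_stdGaussian a)
        refine (lintegral_congr_ae ?_).trans lintegral_zero
        filter_upwards [hcs, hne] with z hz hz0
        have hmy : Measurable fun y : Vec d =>
            B.indicator (1 : (Vec d × Vec d) × Vec d → ℝ≥0∞) (z, s⁻¹ • (y - z.1)) :=
          (measurable_one.indicator hBm).comp (by fun_prop)
        rw [resampleLaw, if_neg h0, lintegral_map hmy measurable_fst]
        refine (lintegral_congr_ae ?_).trans lintegral_zero
        filter_upwards [hcs] with z' hz'
        refine Set.indicator_of_notMem ?_ _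
        rintro ⟨a, ha⟩
        have h5 := abs_sub_le_of_cell_eq hs (hz.trans hz'.symm) (hz0 a)
        simp only [PiLp.smul_apply, PiLp.sub_apply, smul_eq_mul, abs_mul, abs_inv,
          abs_of_pos hs] at ha
        rw [lt_inv_mul_iff₀ hs] at ha
        linarith
    filter_upwards [h2] with z hz a
    by_contra hlt
    exact hz ⟨a, not_le.1 hlt⟩
  · -- accepted moves do not contribute
    intro g hg
    set B : Set ((Vec d × Vec d) × Vec d) := {q | q.2 ≠ q.1.2} with hB
    have hBm : MeasurableSet B :=
      (measurableSet_eq_fun (by fun_prop : Measurable fun q : (Vec d × Vec d) × Vec d => q.2)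
        (by fun_prop : Measurable fun q : (Vec d × Vec d) × Vec d => q.1.2)).compl
    have h1 := lintegral_move hf hf0 s P (resampleLaw f s P)
      (G := B.indicator fun q => g q.1.2) ((hg.comp (by fun_prop)).indicator hBm)
    have e : ∀ z : Vec d × Vec d × Noise d,
        {z : Vec d × Vec d × Noise d | move f s z ≠ z.2.1}.indicator (fun z => g z.2.1) z =
        B.indicator (fun q => g q.1.2) ((z.1, z.2.1), move f s z) := fun z => rfl
    simp only [e]
    rw [h1]
    have e1 : ∀ z : Vec d × Vec d, B.indicator (fun q => g q.1.2) (z, z.2) = 0 := fun z => by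
      simp [hB]
    simp only [e1, mul_zero, lintegral_zero, zero_add]
    refine lintegral_mono fun z => ?_
    gcongr
    calc ∫⁻ y, B.indicator (fun q => g q.1.2) (z, s⁻¹ • (y - z.1)) ∂(resampleLaw f s P (cell s z))
        ≤ ∫⁻ _, g z.2 ∂(resampleLaw f s P (cell s z)) :=
          lintegral_mono fun y => Set.indicator_le_self' (fun _ _ => zero_le) _
      _ = g z.2 := by simp

namespace IsReversibleMove

variable {d : ℕ} {f : Vec d → ℝ} {s : ℝ} {P : Measure (Vec d)}
  {N : Type*} [MeasurableSpace N] {ν : Measure N}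
  {V : Vec d × Vec d × N → Vec d}

theorem map_end [IsProbabilityMeasure ν] (h : IsReversibleMove f s P ν V) :
    (P.prod ((stdGaussian (Vec d)).prod ν)).map (fun z => z.1 + s • V z) = P := by
  have hV := h.measurable
  have h1 := congrArg (Measure.map Prod.snd) h.map_symm
  rw [Measure.map_map (by fun_prop) (by fun_prop),
    Measure.map_map (by fun_prop) (by fun_prop)] at h1
  refine h1.trans ?_
  change (P.prod ((stdGaussian (Vec d)).prod ν)).map Prod.fst = P
  rw [Measure.map_fst_prod]
  simp

theorem map_neg (h : IsReversibleMove f s P ν V) (hs : 0 < s) :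
    (P.prod ((stdGaussian (Vec d)).prod ν)).map V =
      (P.prod ((stdGaussian (Vec d)).prod ν)).map (fun z => -V z) := by
  have hV := h.measurable
  have h1 := congrArg (Measure.map fun q : Vec d × Vec d => s⁻¹ • (q.2 - q.1)) h.map_symm
  rw [Measure.map_map (by fun_prop) (by fun_prop),
    Measure.map_map (by fun_prop) (by fun_prop)] at h1
  convert! h1 using 2
  · ext1 z; simp [smul_smul, inv_mul_cancel₀ hs.ne']
  · ext1 z; simp [smul_smul, inv_mul_cancel₀ hs.ne']

/-- An exchangeable perturbation which is dominated by a standard Gaussian vector is centered and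
sub-Gaussian: by symmetry its Laplace transform is a mean of hyperbolic cosines. -/
theorem isSubGaussianPair [IsProbabilityMeasure P] [IsProbabilityMeasure ν]
    (h : IsReversibleMove f s P ν V) (hs : 0 < s) :
    IsSubGaussianPair P ((P.prod ((stdGaussian (Vec d)).prod ν)).map fun z => (z.1, V z)) := by
  have hV := h.measurable
  set Q := P.prod ((stdGaussian (Vec d)).prod ν) with hQ
  have hm : Measurable fun z : Vec d × Vec d × N => (z.1, V z) := by fun_prop
  have hlaw : ∀ a,
      MeasurePreserving (fun z : Vec d × Vec d × N => z.2.1 a) Q (gaussianReal 0 1) := by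
    intro a
    refine ⟨by fun_prop, ?_⟩
    have h1 : Q.map (fun z => z.2.1) = stdGaussian (Vec d) := by
      have : (fun z : Vec d × Vec d × N => z.2.1) = Prod.fst ∘ Prod.snd := rfl
      rw [this, ← Measure.map_map measurable_fst measurable_snd, hQ, Measure.map_snd_prod]
      simp
    rw [← stdGaussian_map_eval a, ← h1, Measure.map_map (by fun_prop) (by fun_prop)]
    rfl
  have hVa : ∀ a, Measurable fun z => V z a := fun a => by fun_prop
  have hint : ∀ a, Integrable (fun z => V z a) Q := by
    intro a
    have h2 : Integrable (fun z : Vec d × Vec d × N => z.2.1 a) Q :=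
      (hlaw a).integrable_comp_of_integrable (g := id) IsGaussian.integrable_id
    refine h2.mono (hVa a).aestronglyMeasurable ?_
    filter_upwards [h.ae_abs_le] with z hz using hz a
  have hexp : ∀ t : ℝ, ∀ a, Integrable (fun z : Vec d × Vec d × N => Real.exp (t * z.2.1 a)) Q :=
    fun t a => (hlaw a).integrable_comp_of_integrable (integrable_exp_mul_gaussianReal t)
  have hcosh : ∀ t : ℝ, ∀ a, ∀ᵐ z ∂Q, Real.exp (t * V z a) + Real.exp (-t * V z a) ≤
      Real.exp (t * z.2.1 a) + Real.exp (-t * z.2.1 a) := by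
    intro t a
    filter_upwards [h.ae_abs_le] with z hz
    have h3 : Real.cosh (t * V z a) ≤ Real.cosh (t * z.2.1 a) := by
      rw [Real.cosh_le_cosh, abs_mul, abs_mul]
      exact mul_le_mul_of_nonneg_left (hz a) (abs_nonneg t)
    rw [Real.cosh_eq, Real.cosh_eq] at h3
    simp only [neg_mul]
    linarith
  have hexpV : ∀ t : ℝ, ∀ a, Integrable (fun z => Real.exp (t * V z a)) Q := by
    intro t a
    refine ((hexp t a).add (hexp (-t) a)).mono' (by fun_prop) ?_
    filter_upwards [hcosh t a] with z hz
    rw [Real.norm_of_nonneg (Real.exp_pos _).le]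
    have := Real.exp_pos (-t * V z a)
    simp only [Pi.add_apply]
    linarith
  have hswap : ∀ g : Vec d → ℝ, Measurable g → ∫ z, g (V z) ∂Q = ∫ z, g (-V z) ∂Q := by
    intro g hg
    have h4 := h.map_neg hs
    rw [← integral_map hV.aemeasurable hg.aestronglyMeasurable, h4,
      integral_map (by fun_prop) hg.aestronglyMeasurable]
  constructor
  · exact Measure.isProbabilityMeasure_map hm.aemeasurable
  · rw [Measure.map_map measurable_fst hm]
    change Q.map Prod.fst = P
    rw [hQ, Measure.map_fst_prod]; simp
  · intro a
    rw [integrable_map_measure (by fun_prop) hm.aemeasurable]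
    exact hint a
  · intro a
    rw [integral_map hm.aemeasurable (by fun_prop)]
    have h5 := hswap (fun v => v a) (by fun_prop)
    simp only [PiLp.neg_apply, integral_neg] at h5
    simp only
    linarith
  · intro a
    constructor
    · intro t
      rw [integrable_map_measure (by fun_prop) hm.aemeasurable]
      exact hexpV t a
    · intro t
      rw [mgf, integral_map hm.aemeasurable (by fun_prop)]
      have h5 := hswap (fun v => Real.exp (t * v a)) (by fun_prop)
      have h6 : ∫ z, Real.exp (t * V z a) ∂Q + ∫ z, Real.exp (-t * V z a) ∂Q ≤
          ∫ z, Real.exp (t * z.2.1 a) ∂Q + ∫ z, Real.exp (-t * z.2.1 a) ∂Q := by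
        rw [← integral_add (hexpV t a) (hexpV (-t) a), ← integral_add (hexp t a) (hexp (-t) a)]
        exact integral_mono_ae ((hexpV t a).add (hexpV (-t) a)) ((hexp t a).add (hexp (-t) a))
          (hcosh t a)
      have h7 : ∀ t : ℝ, ∫ z, Real.exp (t * z.2.1 a) ∂Q = Real.exp (t ^ 2 / 2) := by
        intro t
        have := mgf_gaussianReal (hlaw a).map_eq t
        simpa [mgf] using this
      rw [h7, h7] at h6
      simp only [PiLp.neg_apply, mul_neg] at h5
      simp only [neg_mul, neg_sq, NNReal.coe_one, one_mul] at h6 ⊢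
      linarith

end IsReversibleMove

theorem integrable_norm_rpow_stdGaussian (d : ℕ) {p : ℝ} (hp : 0 ≤ p) :
    Integrable (fun w : Vec d => ‖w‖ ^ p) (stdGaussian (Vec d)) := by
  rcases hp.eq_or_lt with rfl | hp
  · simp
  · have h1 := IsGaussian.memLp_id (stdGaussian (Vec d)) (ENNReal.ofReal p) (by simp)
    have h2 := h1.integrable_norm_rpow (by simpa using hp) (by simp)
    simpa [ENNReal.toReal_ofReal hp.le] using h2

/-- The rejection condition as a bound for lower Lebesgue integrals. -/
theorem lintegral_rejProb_le {d : ℕ} {f : Vec d → ℝ} (hf : Measurable f) (hf0 : ∀ x, 0 ≤ f x)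
    {P : Measure (Vec d)} [IsProbabilityMeasure P] {p C s : ℝ} (hp : 0 ≤ p)
    (hC : ∫ z : Vec d × Vec d, ‖z.2‖ ^ p * max (1 - f (z.1 + s • z.2) / f z.1) 0
        ∂(P.prod (stdGaussian (Vec d))) ≤ C * s) :
    ∫⁻ z, ENNReal.ofReal (rejProb f s z) * ‖z.2‖ₑ ^ p ∂(P.prod (stdGaussian (Vec d))) ≤
      ENNReal.ofReal (C * s) := by
  have hrm := measurable_rejProb hf s
  have hi : Integrable (fun z : Vec d × Vec d => ‖z.2‖ ^ p * rejProb f s z)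
      (P.prod (stdGaussian (Vec d))) := by
    have h1 : Integrable (fun z : Vec d × Vec d => ‖z.2‖ ^ p) (P.prod (stdGaussian (Vec d))) :=
      (integrable_norm_rpow_stdGaussian d hp).comp_snd P
    refine h1.mono' (by fun_prop) (ae_of_all _ fun z => ?_)
    rw [Real.norm_of_nonneg (mul_nonneg (by positivity) (rejProb_nonneg f s z))]
    exact mul_le_of_le_one_right (by positivity) (rejProb_le_one hf0 s z)
  refine le_trans (le_of_eq ?_) (ENNReal.ofReal_le_ofReal hC)
  have h2 := ofReal_integral_eq_lintegral_ofReal hi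
    (ae_of_all _ fun z => mul_nonneg (by positivity) (rejProb_nonneg f s z))
  refine Eq.trans ?_ h2.symm
  refine lintegral_congr fun z => ?_
  rw [ENNReal.ofReal_mul (by positivity), mul_comm,
    ← ENNReal.ofReal_rpow_of_nonneg (norm_nonneg _) hp,
    ofReal_norm]

/-! ### Independent perturbations of all the inputs -/

section Product

variable {d : ℕ} {I : Type*} {N : Type*} [MeasurableSpace N]

/-- The proposals and the noise of all the coordinates, independent of the inputs. -/
abbrev auxLaw (d : ℕ) (I : Type*) [Fintype I] {N : Type*} [MeasurableSpace N] (ν : Measure N) :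
    Measure ((I → Vec d) × (I → N)) :=
  (iidLaw I (stdGaussian (Vec d))).prod (iidLaw I ν)

/-- The perturbation of all the coordinates by independent copies of `V`. -/
def moveAll (V : Vec d × Vec d × N → Vec d) (z : (I → Vec d) × (I → Vec d) × (I → N)) :
    I → Vec d :=
  fun i => V (z.1 i, z.2.1 i, z.2.2 i)

variable [Fintype I] (P : Measure (Vec d)) [IsProbabilityMeasure P] (ν : Measure N)
  [IsProbabilityMeasure ν]

theorem measurePreserving_zip :
    MeasurePreserving (fun (z : (I → Vec d) × (I → Vec d) × (I → N)) i => (z.1 i, z.2.1 i, z.2.2 i))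
      ((iidLaw I P).prod (auxLaw d I ν)) (iidLaw I (P.prod ((stdGaussian (Vec d)).prod ν))) := by
  have e1 := (measurePreserving_arrowProdEquivProdArrow (Vec d) (Vec d × N) I (fun _ => P)
    (fun _ => (stdGaussian (Vec d)).prod ν)).symm
  have e2 := (measurePreserving_arrowProdEquivProdArrow (Vec d) N I
    (fun _ => stdGaussian (Vec d)) (fun _ => ν)).symm
  exact e1.comp ((MeasurePreserving.id (iidLaw I P)).prod e2)

/-- Independent inputs, proposals and noise, arranged coordinate by coordinate, are i.i.d.; hence so
are their images under a function `G` of a single coordinate. -/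
theorem measurePreserving_zip_comp {β : Type*} [MeasurableSpace β]
    {G : Vec d × Vec d × N → β} (hG : Measurable G) :
    MeasurePreserving
      (fun (z : (I → Vec d) × (I → Vec d) × (I → N)) i => G (z.1 i, z.2.1 i, z.2.2 i))
      ((iidLaw I P).prod (auxLaw d I ν))
      (iidLaw I ((P.prod ((stdGaussian (Vec d)).prod ν)).map G)) := by
  have hp := Measure.isProbabilityMeasure_map
    (μ := P.prod ((stdGaussian (Vec d)).prod ν)) hG.aemeasurable
  have h1 : MeasurePreserving (fun (q : I → Vec d × Vec d × N) i => G (q i))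
      (iidLaw I (P.prod ((stdGaussian (Vec d)).prod ν)))
      (iidLaw I ((P.prod ((stdGaussian (Vec d)).prod ν)).map G)) :=
    measurePreserving_pi _ _ fun _ => ⟨hG, rfl⟩
  exact h1.comp (measurePreserving_zip P ν)

theorem ae_forall_zip {p : Vec d × Vec d × N → Prop}
    (hp : ∀ᵐ z ∂(P.prod ((stdGaussian (Vec d)).prod ν)), p z) :
    ∀ᵐ z ∂((iidLaw I P).prod (auxLaw d I ν)), ∀ i, p (z.1 i, z.2.1 i, z.2.2 i) := by
  have h1 : ∀ᵐ q ∂(iidLaw I (P.prod ((stdGaussian (Vec d)).prod ν))), ∀ i, p (q i) :=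
    ae_all_iff.2 fun i => (measurePreserving_eval
      (fun _ : I => P.prod ((stdGaussian (Vec d)).prod ν)) i).quasiMeasurePreserving.ae hp
  exact (measurePreserving_zip P ν).quasiMeasurePreserving.ae h1

theorem lintegral_zip_eval {g : Vec d × Vec d × N → ℝ≥0∞} (hg : Measurable g) (i : I) :
    ∫⁻ z, g (z.1 i, z.2.1 i, z.2.2 i) ∂((iidLaw I P).prod (auxLaw d I ν)) =
      ∫⁻ z, g z ∂(P.prod ((stdGaussian (Vec d)).prod ν)) :=
  ((measurePreserving_eval (fun _ : I => P.prod ((stdGaussian (Vec d)).prod ν)) i).comp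
    (measurePreserving_zip P ν)).lintegral_comp hg

variable {P ν} {f : Vec d → ℝ} {s : ℝ} {V : Vec d × Vec d × N → Vec d}

/-- The perturbed inputs have the law of the inputs. -/
theorem IsReversibleMove.measurePreserving_end (h : IsReversibleMove f s P ν V) :
    MeasurePreserving (fun z => z.1 + s • moveAll V z)
      ((iidLaw I P).prod (auxLaw d I ν)) (iidLaw I P) := by
  have hV := h.measurable
  have h1 := measurePreserving_zip_comp (I := I) P ν
    (by fun_prop : Measurable fun z : Vec d × Vec d × N => z.1 + s • V z)
  rw [h.map_end] at h1
  exact h1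

/-- The joint law of the input and the step has a density, so that an expansion off a Lebesgue null
set can be used along this pair. -/
theorem IsReversibleMove.quasiMeasurePreserving_pair (h : IsReversibleMove f s P ν V) :
    Measure.QuasiMeasurePreserving (fun z => (z.1, s • moveAll V z))
      ((iidLaw I P).prod (auxLaw d I ν))
      (volume : Measure ((I → Vec d) × (I → Vec d))) := by
  have hV := h.measurable
  have hG : Measurable fun z : Vec d × Vec d × N => (z.1, s • V z) := by fun_prop
  have h1 := (measurePreserving_zip_comp (I := I) P ν hG)
  have hp := Measure.isProbabilityMeasure_map
    (μ := P.prod ((stdGaussian (Vec d)).prod ν)) hG.aemeasurable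
  have h2 : iidLaw I ((P.prod ((stdGaussian (Vec d)).prod ν)).map fun z => (z.1, s • V z)) ≪
      iidLaw I (volume : Measure (Vec d × Vec d)) :=
    iidLaw_absolutelyContinuous h.map_absolutelyContinuous
  have h3 : Measure.QuasiMeasurePreserving
      (fun (z : (I → Vec d) × (I → Vec d) × (I → N)) i =>
        ((z.1 i, s • V (z.1 i, z.2.1 i, z.2.2 i)) : Vec d × Vec d))
      ((iidLaw I P).prod (auxLaw d I ν))
      (iidLaw I (volume : Measure (Vec d × Vec d))) :=
    ⟨h1.measurable, by rw [h1.map_eq]; exact h2⟩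
  have h4 := measurePreserving_arrowProdEquivProdArrow (Vec d) (Vec d) I (fun _ => volume)
    (fun _ => volume)
  exact h4.quasiMeasurePreserving.comp h3

theorem IsReversibleMove.lintegral_sum_rejected_le (h : IsReversibleMove f s P ν V) {p : ℝ}
    {b : ℝ≥0∞} (hb : ∫⁻ z, ENNReal.ofReal (rejProb f s z) * ‖z.2‖ₑ ^ p
      ∂(P.prod (stdGaussian (Vec d))) ≤ b) :
    ∫⁻ z, ∑ i, {z : Vec d × Vec d × N | V z ≠ z.2.1}.indicator (fun z => ‖z.2.1‖ₑ ^ p)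
        (z.1 i, z.2.1 i, z.2.2 i) ∂((iidLaw I P).prod (auxLaw d I ν)) ≤
      (Fintype.card I : ℝ≥0∞) * b := by
  have hV := h.measurable
  have hg : Measurable ({z : Vec d × Vec d × N | V z ≠ z.2.1}.indicator
      (fun z => ‖z.2.1‖ₑ ^ p)) :=
    Measurable.indicator (by fun_prop) (measurableSet_eq_fun hV (by fun_prop)).compl
  rw [lintegral_finsetSum]
  · simp only [lintegral_zip_eval P ν hg]
    rw [Finset.sum_const, Finset.card_univ, nsmul_eq_mul]
    gcongr
    exact (h.lintegral_rejected_le (fun w => ‖w‖ₑ ^ p) (by fun_prop)).trans hb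
  · intro i _
    exact hg.comp (by fun_prop)

/-- The coordinates of a family of independent standard Gaussian vectors. -/
theorem measurePreserving_coord :
    MeasurePreserving (fun (w : I → Vec d) (k : I × Fin d) => w k.1 k.2)
      (iidLaw I (stdGaussian (Vec d))) (Measure.pi fun _ : I × Fin d => gaussianReal 0 1) := by
  have h0 : MeasurePreserving (fun (x : I → Fin d → ℝ) i => WithLp.toLp 2 (x i))
      (iidLaw I (Measure.pi fun _ : Fin d => gaussianReal 0 1)) (iidLaw I (stdGaussian (Vec d))) :=
    measurePreserving_pi _ _ fun _ => ⟨by fun_prop, map_pi_eq_stdGaussian⟩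
  have h1 := Measure.infinitePi_map_curry (ι := I) (κ := Fin d) fun _ _ => gaussianReal 0 1
  simp only [Measure.infinitePi_eq_pi] at h1
  refine ⟨by fun_prop, ?_⟩
  rw [← h0.map_eq, Measure.map_map (by fun_prop) h0.measurable]
  simp only [iidLaw]
  rw [← h1, Measure.map_map (by fun_prop) (MeasurableEquiv.measurable _)]
  convert! Measure.map_id

end Product

/-! ### Packing numbers -/

theorem exists_separated_of_le_packingNumber {S : Type*} {dst : S → S → ℝ} {δ : ℝ} {T : Set S}
    {m : ℕ} (hm : 0 < m) (h : (m : ℕ∞) ≤ packingNumber dst δ T) :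
    ∃ e : Fin m → S, (∀ j, e j ∈ T) ∧ ∀ i j, i ≠ j → δ < dst (e i) (e j) := by
  have h1 : ((m - 1 : ℕ) : ℕ∞) < packingNumber dst δ T :=
    lt_of_lt_of_le (by exact_mod_cast Nat.sub_lt hm one_pos) h
  simp only [packingNumber, lt_iSup_iff] at h1
  obtain ⟨C, hCT, hC, hlt⟩ := h1
  have h2 : (m : ℕ∞) ≤ C.encard := by
    have := Order.add_one_le_of_lt hlt
    have e : ((m - 1 : ℕ) : ℕ∞) + 1 = m := by exact_mod_cast Nat.sub_add_cancel hm
    rwa [e] at this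
  obtain ⟨C', hC'C, hC'⟩ := Set.exists_subset_encard_eq h2
  have hfin : C'.Finite := Set.finite_of_encard_eq_coe hC'
  have hcard : hfin.toFinset.card = m := by
    have := hfin.encard_eq_coe_toFinset_card
    rw [hC'] at this
    exact_mod_cast this.symm
  let e := (hfin.toFinset.equivFinOfCardEq hcard).symm
  have hmem : ∀ j, (e j : S) ∈ C := fun j => hC'C (hfin.mem_toFinset.1 (e j).2)
  refine ⟨fun j => e j, fun j => hCT (hmem j), fun i j hij => hC (hmem i) (hmem j) ?_⟩
  exact fun h => hij (e.injective (Subtype.ext h))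

theorem packingNumber_mono {S : Type*} {dst : S → S → ℝ} {δ δ' : ℝ} (hδ : δ ≤ δ') {T T' : Set S}
    (hT : T' ⊆ T) : packingNumber dst δ' T' ≤ packingNumber dst δ T :=
  iSup_mono fun _ => iSup_mono' fun h => ⟨h.trans hT,
    iSup_mono' fun h' => ⟨fun _ hx _ hy hxy => hδ.trans_lt (h' hx hy hxy), le_rfl⟩⟩

theorem packingNumber_lt_top {S : Type*} [PseudoMetricSpace S] [CompactSpace S] {ε : ℝ}
    (hε : 0 < ε) (T : Set S) : packingNumber (fun s t : S => dist s t) ε T < ⊤ := by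
  refine (packingNumber_mono le_rfl (Set.subset_univ T)).trans_lt ?_
  lift ε to ℝ≥0 using hε.le
  rw [packingNumber_dist]
  have hε2 : ε / 2 ≠ 0 := by
    have : 0 < ε := by exact_mod_cast hε
    positivity
  have h1 := Metric.packingNumber_two_mul_le_externalCoveringNumber (ε / 2) (Set.univ : Set S)
  rw [mul_div_cancel₀ _ two_ne_zero] at h1
  obtain ⟨C, -, hCfin, hC⟩ := Metric.exists_finite_isCover_of_isCompact hε2
    (isCompact_univ : IsCompact (Set.univ : Set S))
  exact (h1.trans (iInf₂_le C hC)).trans_lt hCfin.encard_lt_top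

/-! ### Dominating functions and Hölder's inequality -/

/-- The function `g` is bounded by `c` in `L^p(μ)`; for finite `p` the `p`-th powers are
compared. -/
def LpBound {Ω : Type*} [MeasurableSpace Ω] (μ : Measure Ω) (p : ℝ≥0∞) (g : Ω → ℝ≥0∞)
    (c : ℝ≥0∞) : Prop :=
  (p = ∞ → ∀ᵐ z ∂μ, g z ≤ c) ∧ (p ≠ ∞ → ∫⁻ z, g z ^ p.toReal ∂μ ≤ c ^ p.toReal)

theorem LpBound.comp {Ω Ω' : Type*} [MeasurableSpace Ω] [MeasurableSpace Ω'] {μ : Measure Ω}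
    {μ' : Measure Ω'} {φ : Ω → Ω'} (hφ : MeasurePreserving φ μ μ') {p c : ℝ≥0∞}
    {g : Ω' → ℝ≥0∞} (hg : Measurable g) (h : LpBound μ' p g c) :
    LpBound μ p (fun z => g (φ z)) c := by
  refine ⟨fun hp => hφ.quasiMeasurePreserving.ae (h.1 hp), fun hp => ?_⟩
  rw [hφ.lintegral_comp (f := fun z => g z ^ p.toReal) (by fun_prop)]
  exact h.2 hp

/-- The infimum defining an outer expectation yields measurable dominating functions. -/
theorem exists_measurable_of_outerExp_lt {Ω : Type*} [MeasurableSpace Ω] {μ : Measure Ω}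
    {g : Ω → ℝ≥0∞} {c : ℝ≥0∞} (h : outerExp μ g < c) :
    ∃ k : Ω → ℝ≥0∞, Measurable k ∧ (∀ z, g z ≤ k z) ∧ ∫⁻ z, k z ∂μ ≤ c := by
  simp only [outerExp, iInf_lt_iff] at h
  obtain ⟨k, hk, hgk, hlt⟩ := h
  exact ⟨k, hk, hgk, hlt.le⟩

/-- A function with a small outer `L^p` norm is dominated by a measurable function with small
`L^p` norm. -/
theorem exists_lpBound_of_outerLp_lt {Ω : Type*} [MeasurableSpace Ω] {μ : Measure Ω}
    {g : Ω → ℝ≥0∞} {p c : ℝ≥0∞} (hp : p ≠ 0) (h : outerLp μ p g < c) :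
    ∃ k : Ω → ℝ≥0∞, Measurable k ∧ (∀ᵐ z ∂μ, g z ≤ k z) ∧ LpBound μ p k c := by
  by_cases hpt : p = ∞
  · refine ⟨fun _ => c, measurable_const, ?_, fun _ => ae_of_all _ fun _ => le_rfl,
      fun h' => (h' hpt).elim⟩
    rw [outerLp, if_pos hpt] at h
    filter_upwards [ENNReal.ae_le_essSup g] with z hz using hz.trans h.le
  · have hp0 : 0 < p.toReal := ENNReal.toReal_pos hp hpt
    rw [outerLp, if_neg hpt] at h
    have h2 : outerExp μ (fun x => g x ^ p.toReal) < c ^ p.toReal := by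
      have := ENNReal.rpow_lt_rpow h hp0
      rwa [← ENNReal.rpow_mul, one_div_mul_cancel hp0.ne', ENNReal.rpow_one] at this
    obtain ⟨k, hk, hgk, hle⟩ := exists_measurable_of_outerExp_lt h2
    refine ⟨fun z => k z ^ (1 / p.toReal), by fun_prop, ae_of_all _ fun z => ?_,
      fun h' => (hpt h').elim, fun _ => ?_⟩
    · rw [one_div, ENNReal.le_rpow_inv_iff hp0]
      exact hgk z
    · simpa only [← ENNReal.rpow_mul, one_div_mul_cancel hp0.ne', ENNReal.rpow_one] using hle

theorem lpBound_of_eLpNorm_le {Ω : Type*} [MeasurableSpace Ω] {μ : Measure Ω}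
    {g : Ω → ℝ≥0} {p c : ℝ≥0∞} (hp : p ≠ 0) (h : eLpNorm (fun x => (g x : ℝ)) p μ ≤ c) :
    LpBound μ p (fun z => (g z : ℝ≥0∞)) c := by
  constructor
  · intro hpt
    rw [hpt, eLpNorm_exponent_top] at h
    filter_upwards [ae_le_eLpNormEssSup (f := fun x => (g x : ℝ)) (μ := μ)] with z hz
    simpa using hz.trans h
  · intro hpt
    have hp0 : 0 < p.toReal := ENNReal.toReal_pos hp hpt
    rw [eLpNorm_eq_lintegral_rpow_enorm_toReal hp hpt, one_div, ENNReal.rpow_inv_le_iff hp0] at h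
    simpa using h

/-- Hölder's inequality for the conjugate exponents `1 + γ⁻¹` and `1 + γ`. -/
theorem lintegral_mul_le_of_lpBound {Ω : Type*} [MeasurableSpace Ω] {μ : Measure Ω}
    {g k : Ω → ℝ≥0∞} (hg : Measurable g) (hk : Measurable k) {γ a b : ℝ≥0∞}
    (hga : LpBound μ (1 + γ⁻¹) g a) (hkb : LpBound μ (1 + γ) k b) :
    ∫⁻ z, g z * k z ∂μ ≤ a * b := by
  rcases eq_or_ne γ 0 with rfl | h0
  · have h1 := hga.1 (by simp)
    have h2 := hkb.2 (by simp)
    simp only [add_zero, ENNReal.toReal_one, ENNReal.rpow_one] at h2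
    calc ∫⁻ z, g z * k z ∂μ ≤ ∫⁻ z, a * k z ∂μ := by
          refine lintegral_mono_ae ?_
          filter_upwards [h1] with z hz
          gcongr
      _ = a * ∫⁻ z, k z ∂μ := lintegral_const_mul _ hk
      _ ≤ a * b := by gcongr
  rcases eq_or_ne γ ∞ with rfl | ht
  · have h1 := hkb.1 (by simp)
    have h2 := hga.2 (by simp)
    simp only [ENNReal.inv_top, add_zero, ENNReal.toReal_one, ENNReal.rpow_one] at h2
    calc ∫⁻ z, g z * k z ∂μ ≤ ∫⁻ z, g z * b ∂μ := by
          refine lintegral_mono_ae ?_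
          filter_upwards [h1] with z hz
          gcongr
      _ = (∫⁻ z, g z ∂μ) * b := lintegral_mul_const _ hg
      _ ≤ a * b := by gcongr
  have hr : 0 < γ.toReal := ENNReal.toReal_pos h0 ht
  have h1 := hga.2 (by simp [h0])
  have h2 := hkb.2 (by simp [ht])
  have e1 : (1 + γ⁻¹).toReal = 1 + γ.toReal⁻¹ := by
    rw [ENNReal.toReal_add (by simp) (by simp [h0])]; simp
  have e2 : (1 + γ).toReal = 1 + γ.toReal := by
    rw [ENNReal.toReal_add (by simp) ht]; simp
  rw [e1] at h1
  rw [e2] at h2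
  have hconj : (1 + γ.toReal⁻¹).HolderConjugate (1 + γ.toReal) := by
    rw [Real.holderConjugate_iff]
    constructor
    · have := inv_pos.2 hr
      linarith
    · field_simp
      ring
  have hp1 : 0 < 1 + γ.toReal⁻¹ := by positivity
  have hp2 : 0 < 1 + γ.toReal := by positivity
  refine (ENNReal.lintegral_mul_le_Lp_mul_Lq μ hconj hg.aemeasurable hk.aemeasurable).trans ?_
  gcongr
  · rw [one_div, ENNReal.rpow_inv_le_iff hp1]; exact h1
  · rw [one_div, ENNReal.rpow_inv_le_iff hp2]; exact h2

/-- The bound on the gradient terms yields a dominating function for their pairing with a family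
`a` of random weights, by Hölder's inequality with the exponents `(1 + l) / l` and `1 + l`. -/
theorem exists_dominating_gradient {d : ℕ} {I S Ω : Type*} [Fintype I] [MeasurableSpace Ω]
    {Q : Measure Ω} {P : Measure (Vec d)} {X : Ω → I → Vec d}
    (hX : MeasurePreserving X Q (iidLaw I P)) {T : (I → Vec d) → Set S}
    {H : I → (I → Vec d) → S → Vec d} {l : ℝ} (hl : 0 ≤ l) {c M : ℝ≥0∞}
    (hc : gradSize P T H l < c) {a : I → Ω → ℝ≥0∞} (ha : ∀ i, Measurable (a i))
    (hM : ∫⁻ z, ∑ i, a i z ^ (1 + l) ∂Q ≤ M) :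
    ∃ E : Ω → ℝ≥0∞, Measurable E ∧
      (∀ᵐ z ∂Q, ∀ ω ∈ T (X z), ∑ i, a i z * ‖H i (X z) ω‖ₑ ≤ E z) ∧
      ∫⁻ z, E z ∂Q ≤ M ^ (1 / (1 + l)) * c := by
  have hA : Measurable fun z => ∑ i, a i z ^ (1 + l) := by fun_prop
  rcases hl.eq_or_lt with rfl | hl
  · rw [gradSize, if_pos rfl] at hc
    simp only [add_zero, ENNReal.rpow_one, one_div, inv_one] at hM hA ⊢
    refine ⟨fun z => (∑ i, a i z) * c, hA.mul_const c, ?_, ?_⟩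
    · have h1 := hX.quasiMeasurePreserving.ae (ENNReal.ae_le_essSup (μ := iidLaw I P)
        fun x => ⨆ ω ∈ T x, ⨆ i, ‖H i x ω‖ₑ)
      filter_upwards [h1] with z hz ω hω
      rw [Finset.sum_mul]
      gcongr with i _
      refine le_trans ?_ (hz.trans hc.le)
      exact (le_iSup (fun i => ‖H i (X z) ω‖ₑ) i).trans
        (le_iSup₂ (f := fun ω (_ : ω ∈ T (X z)) => ⨆ i, ‖H i (X z) ω‖ₑ) ω hω)
    · rw [lintegral_mul_const _ hA]
      gcongr
  · rw [gradSize, if_neg hl.ne'] at hc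
    have hconj : (1 + l).HolderConjugate ((1 + l) / l) := by
      rw [Real.holderConjugate_iff]
      constructor
      · linarith
      · field_simp
    have hq : 0 < (1 + l) / l := by positivity
    have h2 : outerExp (iidLaw I P) (fun x => ⨆ ω ∈ T x, ∑ i, ‖H i x ω‖ₑ ^ ((1 + l) / l)) <
        c ^ ((1 + l) / l) := by
      have := ENNReal.rpow_lt_rpow hc hq
      rwa [← ENNReal.rpow_mul, show l / (1 + l) * ((1 + l) / l) = 1 by field_simp,
        ENNReal.rpow_one] at this
    obtain ⟨k, hk, hle, hkc⟩ := exists_measurable_of_outerExp_lt h2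
    have hkX : Measurable fun z => k (X z) := hk.comp hX.measurable
    refine ⟨fun z => (∑ i, a i z ^ (1 + l)) ^ (1 / (1 + l)) * (k (X z)) ^ (1 / ((1 + l) / l)),
      (hA.pow_const _).mul (hkX.pow_const _), ae_of_all _ fun z ω hω => ?_, ?_⟩
    · refine (ENNReal.inner_le_Lp_mul_Lq Finset.univ (fun i => a i z) (fun i => ‖H i (X z) ω‖ₑ)
        hconj).trans (mul_le_mul_right (ENNReal.rpow_le_rpow ?_ (by positivity)) _)
      exact (le_iSup₂ (f := fun ω (_ : ω ∈ T (X z)) => ∑ i, ‖H i (X z) ω‖ₑ ^ ((1 + l) / l))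
        ω hω).trans (hle (X z))
    · have h3 := ENNReal.lintegral_mul_norm_pow_le (μ := Q) hA.aemeasurable hkX.aemeasurable
        (p := 1 / (1 + l)) (q := 1 / ((1 + l) / l)) (by positivity) (by positivity)
        (by field_simp)
      refine h3.trans ?_
      rw [hX.lintegral_comp hk]
      gcongr
      rw [one_div, ENNReal.rpow_inv_le_iff hq]
      exact hkc

/-! ### Large near optimal sets lower the optimal value -/

/-- If the increment `D` of the optimal value is, for every near optimal `ω`, at most the value at
`ω` of a Gaussian process (given the input `x`) up to a remainder, then near optimal sets that are
large for the canonical metric of this process are unlikely. Both sides are integrated with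
respect to the auxiliary randomness first, so that only measurable functions of `x` occur even
though the near optimal set is not a measurable function of `x`. -/
theorem measure_le_packingNumber_le {d : ℕ} {I S Z : Type*} [Fintype I] [MeasurableSpace Z]
    {μ : Measure (I → Vec d)} [IsProbabilityMeasure μ] {κ : Measure Z} [IsProbabilityMeasure κ]
    {W : Z → I → Vec d} (hW : MeasurePreserving W κ (iidLaw I (stdGaussian (Vec d))))
    {T : (I → Vec d) → Set S} (hT : ∀ᵐ x ∂μ, (T x).Nonempty)
    {H : I → (I → Vec d) → S → Vec d} {D E : (I → Vec d) × Z → ℝ}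
    (hD : Integrable D (μ.prod κ)) (hE : Integrable E (μ.prod κ)) {θ s : ℝ} (hs : 0 < s)
    (hle : ∀ᵐ z ∂(μ.prod κ), ∀ ω ∈ T z.1,
      D z ≤ θ + s * ∑ i, inner ℝ (W z.2 i) (H i z.1 ω) + E z)
    {B δ : ℝ} (hB : 0 < B) (hδ : 0 < δ) :
    μ {x | (sudakovCard B : ℕ∞) ≤ packingNumber (gradDist fun i => H i x) δ (T x)} ≤
      ENNReal.ofReal ((θ + ∫ z, E z ∂(μ.prod κ) - ∫ z, D z ∂(μ.prod κ)) / (s * (B * δ))) := by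
  set F : (I → Vec d) × Z → ℝ := fun z => (θ + E z - D z) / s with hF
  have hFi : Integrable F (μ.prod κ) := (((integrable_const θ).add hE).sub hD).div_const s
  have hWc := measurePreserving_coord.comp hW
  -- for a fixed input, the function `F` dominates the Gaussian process indexed by `T x`
  have hdom : ∀ᵐ x ∂μ, (T x).Nonempty ∧ Integrable (fun y => F (x, y)) κ ∧
      ∀ ω ∈ T x, ∀ᵐ y ∂κ, ∑ k : I × Fin d, W y k.1 k.2 * -(H k.1 x ω k.2) ≤ F (x, y) := by
    filter_upwards [hT, hFi.prod_right_ae, Measure.ae_ae_of_ae_prod hle] with x h1 h2 h3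
    refine ⟨h1, h2, fun ω hω => ?_⟩
    filter_upwards [h3] with y hy
    have h4 := hy ω hω
    have h5 : ∑ k : I × Fin d, W y k.1 k.2 * -(H k.1 x ω k.2) =
        -∑ i, inner ℝ (W y i) (H i x ω) := by
      rw [Fintype.sum_prod_type, ← Finset.sum_neg_distrib]
      refine Finset.sum_congr rfl fun i _ => ?_
      rw [PiLp.inner_apply, ← Finset.sum_neg_distrib]
      refine Finset.sum_congr rfl fun a _ => ?_
      simp [mul_comm]
    rw [h5, hF, le_div_iff₀ hs]
    linarith
  set G : (I → Vec d) → ℝ := fun x => ∫ y, F (x, y) ∂κ with hG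
  have hGi : Integrable G μ := hFi.integral_prod_left
  -- the Gibbs bound for a single point: the process is centered
  have hG0 : 0 ≤ᵐ[μ] G := by
    filter_upwards [hdom] with x hx
    obtain ⟨⟨ω, hω⟩, hi, hx⟩ := hx
    have := le_integral_of_gaussian_le (J := Unit) hWc hi (fun _ k => -(H k.1 x ω k.2))
      (fun _ => hx ω hω) (β := 0) (δ := 0) (D := 0) le_rfl (by simp) (by simp)
    simpa using this
  have hGB : ∀ᵐ x ∂μ, (sudakovCard B : ℕ∞) ≤ packingNumber (gradDist fun i => H i x) δ (T x) →
      B * δ ≤ G x := by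
    filter_upwards [hdom] with x hx hcard
    obtain ⟨-, hi, hx⟩ := hx
    obtain ⟨e, heT, hesep⟩ := exists_separated_of_le_packingNumber (sudakovCard_pos B) hcard
    refine soft_sudakov hWc hi hB (fun j k => -(H k.1 x (e j) k.2)) (fun j => hx _ (heT j)) hδ ?_
    intro i j hij
    have h6 := (hesep i j hij).le
    rw [gradDist] at h6
    have h7 := (Real.le_sqrt' hδ).1 h6
    refine h7.trans (le_of_eq ?_)
    rw [Fintype.sum_prod_type]
    refine Finset.sum_congr rfl fun l _ => ?_
    rw [EuclideanSpace.real_norm_sq_eq]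
    refine Finset.sum_congr rfl fun a _ => ?_
    simp only [PiLp.sub_apply]
    ring
  have hBδ : 0 < B * δ := mul_pos hB hδ
  have hmarkov := mul_meas_ge_le_integral_of_nonneg hG0 hGi (B * δ)
  have hGint : ∫ x, G x ∂μ = (θ + ∫ z, E z ∂(μ.prod κ) - ∫ z, D z ∂(μ.prod κ)) / s := by
    rw [hG, ← integral_prod _ hFi, hF, integral_div,
      integral_sub (f := fun z => θ + E z) ((integrable_const θ).add hE) hD,
      integral_add (integrable_const θ) hE]
    simp
  calc μ {x | (sudakovCard B : ℕ∞) ≤ packingNumber (gradDist fun i => H i x) δ (T x)}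
      ≤ μ {x | B * δ ≤ G x} := measure_mono_ae hGB
    _ = ENNReal.ofReal (μ.real {x | B * δ ≤ G x}) := by simp
    _ ≤ _ := by
      refine ENNReal.ofReal_le_ofReal ?_
      rw [← div_div, ← hGint, le_div_iff₀ hBδ, mul_comm]
      exact hmarkov

/-! ### The estimate for one minimization problem -/

section OneProblem

variable {d : ℕ} {I S : Type*}

theorem toReal_optValue_le {ψ : (I → Vec d) → S → ℝ} {x : I → Vec d} (h : optValue ψ x ≠ ⊥)
    (ω : S) : (optValue ψ x).toReal ≤ ψ x ω := by
  have h1 : optValue ψ x ≤ (ψ x ω : EReal) := iInf_le _ ω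
  have h2 := EReal.toReal_le_toReal h1 h (EReal.coe_ne_top _)
  simpa using h2

theorem coe_toReal_optValue [Nonempty S] {ψ : (I → Vec d) → S → ℝ} {x : I → Vec d}
    (h : optValue ψ x ≠ ⊥) : ((optValue ψ x).toReal : EReal) = optValue ψ x := by
  obtain ⟨ω⟩ := ‹Nonempty S›
  have h1 : optValue ψ x ≤ (ψ x ω : EReal) := iInf_le _ ω
  exact EReal.coe_toReal (h1.trans_lt (EReal.coe_lt_top _)).ne h

theorem mem_nearOptimal_iff [Nonempty S] {ψ : (I → Vec d) → S → ℝ} {x : I → Vec d}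
    (h : optValue ψ x ≠ ⊥) {θ : ℝ} {ω : S} :
    ω ∈ nearOptimal ψ θ x ↔ ψ x ω ≤ (optValue ψ x).toReal + θ := by
  rw [nearOptimal, Set.mem_ofPred_eq, ← coe_toReal_optValue h]
  simp only [EReal.toReal_coe]
  norm_cast

theorem nearOptimal_nonempty [Nonempty S] {ψ : (I → Vec d) → S → ℝ} {x : I → Vec d}
    (h : optValue ψ x ≠ ⊥) {θ : ℝ} (hθ : 0 < θ) : (nearOptimal ψ θ x).Nonempty := by
  have h1 : optValue ψ x < (((optValue ψ x).toReal + θ : ℝ) : EReal) := by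
    conv_lhs => rw [← coe_toReal_optValue h]
    exact_mod_cast lt_add_of_pos_right _ hθ
  obtain ⟨ω, hω⟩ := iInf_lt_iff.1 h1
  exact ⟨ω, (mem_nearOptimal_iff h).2 (by exact_mod_cast hω.le)⟩

variable [Fintype I] [Nonempty S] {N : Type*} [MeasurableSpace N] {L : ℕ}

/-- The probability that the near optimal set is large for the pseudo-metric of the gradients. The
input `x` is moved to `x + sV` by a reversible move, which leaves the mean optimal value unchanged,
although, up to errors, the optimal value drops by `s` times the maximum of a Gaussian process over
the near optimal set. The error terms come from the rejected moves and from the remainder of the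
expansion. -/
theorem measure_le_packingNumber_nearOptimal_le {P : Measure (Vec d)} [IsProbabilityMeasure P]
    {ν : Measure N} [IsProbabilityMeasure ν] {f : Vec d → ℝ} {s : ℝ} (hs : 0 < s)
    {V : Vec d × Vec d × N → Vec d} (hV : IsReversibleMove f s P ν V)
    {ψ : (I → Vec d) → S → ℝ} (hfin : ∀ᵐ x ∂(iidLaw I P), optValue ψ x ≠ ⊥)
    (hint : Integrable (fun x => (optValue ψ x).toReal) (iidLaw I P))
    {H : I → (I → Vec d) → S → Vec d}
    {R : Fin L → (I → Vec d) → (I → Vec d) → S → ℝ≥0} {R' : Fin L → (I → Vec d) → ℝ≥0}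
    (hR'm : ∀ j, Measurable (R' j)) (hTaylor : TaylorUpper ψ H R R')
    {θ l : ℝ} (hθ : 0 < θ) (hl : 0 ≤ l) {γ : Fin L → ℝ≥0∞} {υ : Fin L → ℝ} {C cH : ℝ}
    (hC : 0 ≤ C) (hcH : 0 ≤ cH) {c c' : Fin L → ℝ} (hc : ∀ j, 0 ≤ c j) (hc' : ∀ j, 0 ≤ c' j)
    (hrej : ∫⁻ z, ENNReal.ofReal (rejProb f s z) * ‖z.2‖ₑ ^ (1 + l)
      ∂(P.prod (stdGaussian (Vec d))) ≤ ENNReal.ofReal (C * s))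
    (hH : gradSize P (nearOptimal ψ θ) H l < ENNReal.ofReal cH)
    (hR : ∀ j, ∃ r : (I → Vec d) × (I → Vec d) × (I → N) → ℝ≥0∞, Measurable r ∧
      (∀ᵐ z ∂((iidLaw I P).prod (auxLaw d I ν)), ∀ ω ∈ nearOptimal ψ θ z.1,
        (R j z.1 (s • moveAll V z) ω : ℝ≥0∞) ≤ ENNReal.ofReal (s ^ (1 + υ j)) * r z) ∧
      LpBound ((iidLaw I P).prod (auxLaw d I ν)) (1 + (γ j)⁻¹) r (ENNReal.ofReal (c j)))
    (hR' : ∀ j, eLpNorm (fun x => (R' j x : ℝ)) (1 + γ j) (iidLaw I P) ≤ ENNReal.ofReal (c' j))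
    {B δ : ℝ} (hB : 0 < B) (hδ : 0 < δ) :
    iidLaw I P {x | (sudakovCard B : ℕ∞) ≤
        packingNumber (gradDist fun i => H i x) δ (nearOptimal ψ θ x)} ≤
      ENNReal.ofReal ((θ + (2 * s * (((Fintype.card I : ℝ) * (C * s)) ^ (1 / (1 + l)) * cH) +
        ∑ j, s ^ (1 + υ j) * (c j * c' j))) / (s * (B * δ))) := by
  classical
  have hVm := hV.measurable
  set Q := (iidLaw I P).prod (auxLaw d I ν) with hQ
  have hend := hV.measurePreserving_end (I := I)
  have hfst : MeasurePreserving (Prod.fst : (I → Vec d) × (I → Vec d) × (I → N) → I → Vec d) Q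
      (iidLaw I P) := measurePreserving_fst
  -- the norms of the rejected proposals
  set a : I → (I → Vec d) × (I → Vec d) × (I → N) → ℝ≥0∞ := fun i z =>
    {z : Vec d × Vec d × N | V z ≠ z.2.1}.indicator (fun z => ‖z.2.1‖ₑ)
      (z.1 i, z.2.1 i, z.2.2 i) with ha
  have ham : ∀ i, Measurable (a i) := by
    intro i
    have hg : Measurable ({z : Vec d × Vec d × N | V z ≠ z.2.1}.indicator
        (fun z => ‖z.2.1‖ₑ)) :=
      Measurable.indicator (by fun_prop) (measurableSet_eq_fun hVm (by fun_prop)).compl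
    exact hg.comp (by fun_prop)
  have hM : ∫⁻ z, ∑ i, a i z ^ (1 + l) ∂Q ≤
      (Fintype.card I : ℝ≥0∞) * ENNReal.ofReal (C * s) := by
    refine le_trans (le_of_eq ?_) (hV.lintegral_sum_rejected_le hrej)
    refine lintegral_congr fun z => Finset.sum_congr rfl fun i _ => ?_
    simp only [ha, Set.indicator]
    split_ifs
    · rfl
    · rw [ENNReal.zero_rpow_of_pos (by positivity)]
  obtain ⟨E, hEm, hE, hEM⟩ := exists_dominating_gradient hfst hl hH ham hM
  choose r hrm hr hrb using hR
  -- replacing `V` by the proposal `w` costs at most `2‖w‖` per rejected coordinate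
  set Rem : (I → Vec d) × (I → Vec d) × (I → N) → ℝ≥0∞ := fun z =>
    ENNReal.ofReal (2 * s) * E z + ∑ j, ENNReal.ofReal (s ^ (1 + υ j)) *
      (r j z * (R' j (z.1 + s • moveAll V z) : ℝ≥0∞)) with hRem
  have hR'e : ∀ j, Measurable fun z : (I → Vec d) × (I → Vec d) × (I → N) =>
      (R' j (z.1 + s • moveAll V z) : ℝ≥0∞) := fun j =>
    ((hR'm j).comp hend.measurable).coe_nnreal_ennreal
  have hrR : ∀ j, Measurable fun z : (I → Vec d) × (I → Vec d) × (I → N) =>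
      r j z * (R' j (z.1 + s • moveAll V z) : ℝ≥0∞) := fun j => (hrm j).mul (hR'e j)
  have hsrR : ∀ j, Measurable fun z : (I → Vec d) × (I → Vec d) × (I → N) =>
      ENNReal.ofReal (s ^ (1 + υ j)) * (r j z * (R' j (z.1 + s • moveAll V z) : ℝ≥0∞)) :=
    fun j => (hrR j).const_mul _
  have hsum : Measurable fun z => ∑ j, ENNReal.ofReal (s ^ (1 + υ j)) *
      (r j z * (R' j (z.1 + s • moveAll V z) : ℝ≥0∞)) :=
    Finset.measurable_sum _ fun j _ => hsrR j
  have hRemm : Measurable Rem := (hEm.const_mul _).add hsum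
  set b : ℝ := 2 * s * (((Fintype.card I : ℝ) * (C * s)) ^ (1 / (1 + l)) * cH) +
    ∑ j, s ^ (1 + υ j) * (c j * c' j) with hb
  have hRemb : ∫⁻ z, Rem z ∂Q ≤ ENNReal.ofReal b := by
    have h1 : ∀ j, ∫⁻ z, r j z * (R' j (z.1 + s • moveAll V z) : ℝ≥0∞) ∂Q ≤
        ENNReal.ofReal (c j) * ENNReal.ofReal (c' j) := fun j =>
      lintegral_mul_le_of_lpBound (hrm j) (hR'e j) (hrb j)
        ((lpBound_of_eLpNorm_le (by simp) (hR' j)).comp hend (hR'm j).coe_nnreal_ennreal)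
    have h2 : ENNReal.ofReal b = ENNReal.ofReal (2 * s) *
        (((Fintype.card I : ℝ≥0∞) * ENNReal.ofReal (C * s)) ^ (1 / (1 + l)) *
          ENNReal.ofReal cH) +
        ∑ j, ENNReal.ofReal (s ^ (1 + υ j)) * (ENNReal.ofReal (c j) * ENNReal.ofReal (c' j)) := by
      rw [hb, ENNReal.ofReal_add (by positivity)
        (Finset.sum_nonneg fun j _ => mul_nonneg (by positivity) (mul_nonneg (hc j) (hc' j))),
        ENNReal.ofReal_sum_of_nonneg
          fun j _ => mul_nonneg (by positivity) (mul_nonneg (hc j) (hc' j)),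
        ENNReal.ofReal_mul (by positivity : (0 : ℝ) ≤ 2 * s),
        ENNReal.ofReal_mul
          (by positivity : (0 : ℝ) ≤ ((Fintype.card I : ℝ) * (C * s)) ^ (1 / (1 + l))),
        ← ENNReal.ofReal_rpow_of_nonneg (by positivity) (by positivity),
        ENNReal.ofReal_mul (by positivity : (0 : ℝ) ≤ (Fintype.card I : ℝ)), ENNReal.ofReal_natCast]
      congr 1
      refine Finset.sum_congr rfl fun j _ => ?_
      rw [ENNReal.ofReal_mul (by positivity), ENNReal.ofReal_mul (hc j)]
    rw [h2, hRem, lintegral_add_left (hEm.const_mul _), lintegral_const_mul _ hEm,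
      lintegral_finsetSum _ fun j _ => hsrR j]
    gcongr with j _
    rw [lintegral_const_mul _ (hrR j)]
    gcongr
    exact h1 j
  have hRemtop : ∀ᵐ z ∂Q, Rem z < ∞ :=
    ae_lt_top hRemm (hRemb.trans_lt ENNReal.ofReal_lt_top).ne
  have hRemi : Integrable (fun z => (Rem z).toReal) Q :=
    integrable_toReal_of_lintegral_ne_top hRemm.aemeasurable
      (hRemb.trans_lt ENNReal.ofReal_lt_top).ne
  have hb0 : 0 ≤ b := add_nonneg (by positivity)
    (Finset.sum_nonneg fun j _ => mul_nonneg (by positivity) (mul_nonneg (hc j) (hc' j)))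
  have hRemint : ∫ z, (Rem z).toReal ∂Q ≤ b := by
    rw [integral_toReal hRemm.aemeasurable hRemtop]
    exact ENNReal.toReal_le_of_le_ofReal hb0 hRemb
  -- the increment of the optimal value has mean zero
  set D : (I → Vec d) × (I → Vec d) × (I → N) → ℝ := fun z =>
    (optValue ψ (z.1 + s • moveAll V z)).toReal - (optValue ψ z.1).toReal with hD
  have hD1 : Integrable (fun z : (I → Vec d) × (I → Vec d) × (I → N) =>
      (optValue ψ (z.1 + s • moveAll V z)).toReal) Q :=
    hend.integrable_comp_of_integrable hint
  have hD2 : Integrable (fun z : (I → Vec d) × (I → Vec d) × (I → N) =>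
      (optValue ψ z.1).toReal) Q :=
    hfst.integrable_comp_of_integrable hint
  have hDint : ∫ z, D z ∂Q = 0 := by
    rw [hD, integral_sub hD1 hD2, sub_eq_zero]
    have e1 := integral_map (φ := fun z => z.1 + s • moveAll V z) (μ := Q)
      hend.measurable.aemeasurable (f := fun x => (optValue ψ x).toReal)
      (by rw [hend.map_eq]; exact hint.1)
    have e2 := integral_map (φ := Prod.fst) (μ := Q)
      hfst.measurable.aemeasurable (f := fun x => (optValue ψ x).toReal)
      (by rw [hfst.map_eq]; exact hint.1)
    rw [← e1, ← e2, hend.map_eq, hfst.map_eq]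
  -- compare the new optimal value with the value of a near optimal `ω` at the new input
  have hpath : ∀ᵐ z ∂Q, ∀ ω ∈ nearOptimal ψ θ z.1,
      D z ≤ θ + s * ∑ i, inner ℝ (z.2.1 i) (H i z.1 ω) + (Rem z).toReal := by
    have hTay := (hV.quasiMeasurePreserving_pair (I := I)).ae hTaylor
    have hfin1 := hfst.quasiMeasurePreserving.ae hfin
    have hfin2 := hend.quasiMeasurePreserving.ae hfin
    have habs := ae_forall_zip (I := I) P ν hV.ae_norm_le
    filter_upwards [hTay, hfin1, hfin2, habs, hE, ae_all_iff.2 hr, hRemtop] with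
      z hTay hfin1 hfin2 habs hE hr hRemtop ω hω
    have h1 := toReal_optValue_le hfin2 ω
    have h2 := (mem_nearOptimal_iff hfin1).1 hω
    have h3 := hTay ω
    have hdiff : ∀ i, ‖moveAll V z i - z.2.1 i‖ₑ ≤ 2 * a i z := by
      intro i
      simp only [ha, moveAll, Set.indicator, Set.mem_ofPred_eq]
      split_ifs with hne
      · have hnorm : ‖V (z.1 i, z.2.1 i, z.2.2 i)‖ₑ ≤ ‖z.2.1 i‖ₑ :=
          enorm_le_iff_norm_le.2 (habs i)
        refine (enorm_sub_le).trans ?_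
        rw [two_mul]
        gcongr
      · rw [not_not] at hne
        simp [hne]
    have h4 : ∑ i, inner ℝ ((s • moveAll V z) i) (H i z.1 ω) ≤
        s * ∑ i, inner ℝ (z.2.1 i) (H i z.1 ω) +
          s * ∑ i, ‖moveAll V z i - z.2.1 i‖ * ‖H i z.1 ω‖ := by
      rw [← mul_add, ← Finset.sum_add_distrib, Finset.mul_sum]
      refine Finset.sum_le_sum fun i _ => ?_
      rw [Pi.smul_apply, real_inner_smul_left]
      have e : moveAll V z i = z.2.1 i + (moveAll V z i - z.2.1 i) := by abel
      have h5 := real_inner_le_norm (moveAll V z i - z.2.1 i) (H i z.1 ω)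
      gcongr
      calc inner ℝ (moveAll V z i) (H i z.1 ω)
          = inner ℝ (z.2.1 i) (H i z.1 ω) +
            inner ℝ (moveAll V z i - z.2.1 i) (H i z.1 ω) := by
            rw [← inner_add_left, ← e]
        _ ≤ _ := by gcongr
    have h6 : s * ∑ i, ‖moveAll V z i - z.2.1 i‖ * ‖H i z.1 ω‖ +
        ∑ j, (R j z.1 (s • moveAll V z) ω : ℝ) * (R' j (z.1 + s • moveAll V z) : ℝ) ≤
        (Rem z).toReal := by
      rw [← ENNReal.ofReal_le_iff_le_toReal hRemtop.ne]
      refine ENNReal.ofReal_add_le.trans ?_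
      rw [hRem]
      refine add_le_add ?_ ?_
      · rw [ENNReal.ofReal_mul hs.le, mul_comm 2 s, ENNReal.ofReal_mul hs.le, mul_assoc]
        gcongr
        rw [ENNReal.ofReal_sum_of_nonneg fun i _ => by positivity]
        refine le_trans ?_ (mul_le_mul_right (hE ω hω) _)
        rw [Finset.mul_sum]
        refine Finset.sum_le_sum fun i _ => ?_
        rw [ENNReal.ofReal_mul (norm_nonneg _), ofReal_norm, ofReal_norm, ← mul_assoc]
        gcongr
        simpa using hdiff i
      · rw [ENNReal.ofReal_sum_of_nonneg fun i _ => by positivity]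
        refine Finset.sum_le_sum fun j _ => ?_
        rw [ENNReal.ofReal_mul (by positivity), ENNReal.ofReal_coe_nnreal,
          ENNReal.ofReal_coe_nnreal, ← mul_assoc]
        gcongr
        exact hr j ω hω
    simp only [hD]
    linarith
  have hW : MeasurePreserving (Prod.fst : (I → Vec d) × (I → N) → I → Vec d) (auxLaw d I ν)
      (iidLaw I (stdGaussian (Vec d))) := measurePreserving_fst
  have hmain := measure_le_packingNumber_le hW
    (hfin.mono fun x hx => nearOptimal_nonempty hx hθ) (hD1.sub hD2) hRemi hs hpath hB hδ
  refine hmain.trans (ENNReal.ofReal_le_ofReal ?_)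
  have hpos : 0 < s * (B * δ) := by positivity
  rw [div_le_div_iff_of_pos_right hpos]
  have e3 : ∫ z, D z ∂((iidLaw I P).prod (auxLaw d I ν)) = 0 := hDint
  have e4 : ∫ z, (Rem z).toReal ∂((iidLaw I P).prod (auxLaw d I ν)) ≤ b := hRemint
  have e5 := e3
  rw [hD] at e5
  simp only [Pi.sub_apply] at e5 ⊢
  linarith

end OneProblem

/-! ### The remainder terms -/

section Remainder

variable {d : ℕ} {I S : Type*} [Fintype I] {N : Type*} [MeasurableSpace N]

/-- If the remainder of the step `sV` is at most `s ^ (1 + υ)` times the remainder of a step `G`,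
then a moment bound for the latter yields the dominating function which
`measure_le_packingNumber_nearOptimal_le` asks for. For homogeneous remainders `G = V`; under
monotonicity `G` can be the Gaussian proposal, which dominates `V`. -/
theorem exists_dominating_remainder {P : Measure (Vec d)} [IsProbabilityMeasure P]
    {ν : Measure N} [IsProbabilityMeasure ν] {T : (I → Vec d) → Set S}
    {r : (I → Vec d) → (I → Vec d) → S → ℝ≥0} {V G : Vec d × Vec d × N → Vec d}
    (hG : Measurable G) {s υ : ℝ} (hs : 0 < s) {γ c : ℝ≥0∞}
    (hle : ∀ᵐ z ∂((iidLaw I P).prod (auxLaw d I ν)), ∀ ω,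
      (r z.1 (s • moveAll V z) ω : ℝ) ≤ s ^ (1 + υ) * (r z.1 (moveAll G z) ω : ℝ))
    (hc : remainderSize ((P.prod ((stdGaussian (Vec d)).prod ν)).map fun z => (z.1, G z)) T r γ <
      c) :
    ∃ k : (I → Vec d) × (I → Vec d) × (I → N) → ℝ≥0∞, Measurable k ∧
      (∀ᵐ z ∂((iidLaw I P).prod (auxLaw d I ν)), ∀ ω ∈ T z.1,
        (r z.1 (s • moveAll V z) ω : ℝ≥0∞) ≤ ENNReal.ofReal (s ^ (1 + υ)) * k z) ∧
      LpBound ((iidLaw I P).prod (auxLaw d I ν)) (1 + γ⁻¹) k c := by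
  have hpair := measurePreserving_zip_comp (I := I) P ν
    (by fun_prop : Measurable fun z : Vec d × Vec d × N => (z.1, G z))
  obtain ⟨k, hk, hgk, hkb⟩ := exists_lpBound_of_outerLp_lt (by simp) hc
  refine ⟨_, hk.comp hpair.measurable, ?_, hkb.comp hpair hk⟩
  filter_upwards [hle, hpair.quasiMeasurePreserving.ae hgk] with z h1 h2 ω hω
  have h3 : (r z.1 (moveAll G z) ω : ℝ≥0∞) ≤ k fun i => (z.1 i, G (z.1 i, z.2.1 i, z.2.2 i)) :=
    (le_iSup₂ (f := fun ω (_ : ω ∈ T z.1) => (r z.1 (moveAll G z) ω : ℝ≥0∞)) ω hω).trans h2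
  calc (r z.1 (s • moveAll V z) ω : ℝ≥0∞)
      = ENNReal.ofReal (r z.1 (s • moveAll V z) ω : ℝ) := ENNReal.ofReal_coe_nnreal.symm
    _ ≤ ENNReal.ofReal (s ^ (1 + υ) * (r z.1 (moveAll G z) ω : ℝ)) :=
        ENNReal.ofReal_le_ofReal (h1 ω)
    _ = ENNReal.ofReal (s ^ (1 + υ)) * (r z.1 (moveAll G z) ω : ℝ≥0∞) := by
        rw [ENNReal.ofReal_mul (by positivity), ENNReal.ofReal_coe_nnreal]
    _ ≤ _ := mul_le_mul_right h3 _

variable {P : Measure (Vec d)} [IsProbabilityMeasure P] {ν : Measure N} [IsProbabilityMeasure ν]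
  {f : Vec d → ℝ} {s υ : ℝ} {V : Vec d × Vec d × N → Vec d}

theorem IsReversibleMove.ae_le_of_monotoneHomogeneous (hV : IsReversibleMove f s P ν V)
    (hs : 0 < s) {r : (I → Vec d) → (I → Vec d) → S → ℝ≥0} (hr : MonotoneHomogeneous r υ) :
    ∀ᵐ z ∂((iidLaw I P).prod (auxLaw d I ν)), ∀ ω, (r z.1 (s • moveAll V z) ω : ℝ) ≤
      s ^ (1 + υ) * (r z.1 (moveAll (fun z : Vec d × Vec d × N => z.2.1) z) ω : ℝ) := by
  filter_upwards [ae_forall_zip (I := I) P ν hV.ae_norm_le] with z hz ω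
  exact hr _ _ _ s hs hz ω

end Remainder

/-! ### The choice of the step size -/

/-- The step size is the minimum in the growth condition on the window lengths. -/
def stepSize {L : ℕ} (k τ ς l : ℝ) (q υ : Fin L → ℝ) : ℝ :=
  Finset.univ.fold min (τ ^ (1 + l) / (k * ς ^ (1 + l))) fun j => (τ / q j) ^ (1 / υ j)

section StepSize

variable {L : ℕ} {k τ ς l : ℝ} {q υ : Fin L → ℝ}

theorem stepSize_pos (hk : 0 < k) (hτ : 0 < τ) (hς : 0 < ς) (hq : ∀ j, 0 < q j) :
    0 < stepSize k τ ς l q υ := by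
  rw [stepSize, Finset.lt_fold_min]
  exact ⟨by positivity, fun j _ => by have := hq j; positivity⟩

theorem rpow_mul_stepSize_mul_le (hk : 0 < k) (hτ : 0 < τ) (hς : 0 < ς) (hq : ∀ j, 0 < q j)
    (hl : 0 ≤ l) : (k * stepSize k τ ς l q υ) ^ (1 / (1 + l)) * ς ≤ τ := by
  have h0 := stepSize_pos (l := l) (υ := υ) hk hτ hς hq
  have h1 : stepSize k τ ς l q υ ≤ τ ^ (1 + l) / (k * ς ^ (1 + l)) :=
    ((Finset.le_fold_min _).1 le_rfl).1
  have h2 : k * stepSize k τ ς l q υ ≤ (τ / ς) ^ (1 + l) := by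
    rw [Real.div_rpow hτ.le hς.le]
    refine (mul_le_mul_of_nonneg_left h1 hk.le).trans (le_of_eq ?_)
    field_simp
  have h3 := Real.rpow_le_rpow (by positivity) h2 (by positivity : 0 ≤ 1 / (1 + l))
  rw [← Real.rpow_mul (by positivity), mul_one_div_cancel (by positivity), Real.rpow_one] at h3
  rwa [← le_div_iff₀ hς]

theorem stepSize_rpow_mul_le (hk : 0 < k) (hτ : 0 < τ) (hς : 0 < ς) (hq : ∀ j, 0 < q j)
    (j : Fin L) (hυ : 0 < υ j) : stepSize k τ ς l q υ ^ υ j * q j ≤ τ := by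
  have h0 := stepSize_pos (l := l) (υ := υ) hk hτ hς hq
  have hqj := hq j
  have h1 : stepSize k τ ς l q υ ≤ (τ / q j) ^ (1 / υ j) :=
    ((Finset.le_fold_min _).1 le_rfl).2 j (Finset.mem_univ j)
  have h3 := Real.rpow_le_rpow h0.le h1 hυ.le
  rw [← Real.rpow_mul (by positivity), one_div_mul_cancel hυ.ne', Real.rpow_one] at h3
  rwa [← le_div_iff₀ hqj]

/-- With this step size every term of the estimate in `measure_le_packingNumber_nearOptimal_le`
is of the order `τ s`. -/
theorem error_div_le (hk : 0 < k) (hτ : 0 < τ) (hς : 0 < ς) {q q' : Fin L → ℝ}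
    (hq : ∀ j, 0 < q j) (hq' : ∀ j, 0 < q' j) (hl : 0 ≤ l) (hυ : ∀ j, 0 < υ j)
    {s : ℝ} (hs : s = stepSize k τ ς l (fun j => q j * q' j) υ) {θ C a cH B κ : ℝ}
    {c c' : Fin L → ℝ} (hC : 0 ≤ C) (hcH : 0 ≤ cH) (hc : ∀ j, 0 ≤ c j) (hc' : ∀ j, 0 ≤ c' j)
    (hθ : θ ≤ a * (τ * s)) (hB : 0 < B) (hκ : 0 < κ) :
    (θ + (2 * s * ((k * (C * s)) ^ (1 / (1 + l)) * (cH * ς)) +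
        ∑ j, s ^ (1 + υ j) * (c j * q j * (c' j * q' j)))) / (s * (B * (τ * κ))) ≤
      (a + 2 * C ^ (1 / (1 + l)) * cH + ∑ j, c j * c' j) / κ / B := by
  have hqq : ∀ j, 0 < q j * q' j := fun j => mul_pos (hq j) (hq' j)
  have h0 : 0 < s := hs ▸ stepSize_pos hk hτ hς hqq
  have h1 : (k * s) ^ (1 / (1 + l)) * ς ≤ τ := hs ▸ rpow_mul_stepSize_mul_le hk hτ hς hqq hl
  have h2 : ∀ j, s ^ υ j * (q j * q' j) ≤ τ := fun j =>
    hs ▸ stepSize_rpow_mul_le hk hτ hς hqq j (hυ j)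
  have e1 : (k * (C * s)) ^ (1 / (1 + l)) = C ^ (1 / (1 + l)) * (k * s) ^ (1 / (1 + l)) := by
    rw [← Real.mul_rpow hC (by positivity)]
    congr 1
    ring
  have t1 : 2 * s * ((k * (C * s)) ^ (1 / (1 + l)) * (cH * ς)) ≤
      2 * C ^ (1 / (1 + l)) * cH * (τ * s) := by
    rw [e1]
    calc _ = 2 * s * C ^ (1 / (1 + l)) * cH * ((k * s) ^ (1 / (1 + l)) * ς) := by ring
      _ ≤ 2 * s * C ^ (1 / (1 + l)) * cH * τ := by gcongr
      _ = _ := by ring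
  have t2 : ∑ j, s ^ (1 + υ j) * (c j * q j * (c' j * q' j)) ≤ (∑ j, c j * c' j) * (τ * s) := by
    rw [Finset.sum_mul]
    refine Finset.sum_le_sum fun j _ => ?_
    have hcc := mul_nonneg (hc j) (hc' j)
    rw [Real.rpow_add h0, Real.rpow_one]
    calc _ = s * (c j * c' j) * (s ^ υ j * (q j * q' j)) := by ring
      _ ≤ s * (c j * c' j) * τ := by gcongr; exact h2 j
      _ = _ := by ring
  rw [div_div, div_le_div_iff₀ (by positivity) (by positivity)]
  calc _ ≤ (a * (τ * s) + (2 * C ^ (1 / (1 + l)) * cH * (τ * s) +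
        (∑ j, c j * c' j) * (τ * s))) * (κ * B) := by gcongr
    _ = _ := by ring

end StepSize

/-! ### Sequences of minimization problems -/

theorem IsBigOSeq.exists_lt {a : ℕ → ℝ≥0∞} {b : ℕ → ℝ} (h : IsBigOSeq a b) (hb : ∀ n, 0 < b n) :
    ∃ C : ℝ, 0 ≤ C ∧ ∀ᶠ n in atTop, a n < ENNReal.ofReal (C * b n) := by
  obtain ⟨C, hC⟩ := h
  refine ⟨C + 1, by positivity, hC.mono fun n hn => hn.trans_lt ?_⟩
  rw [← ENNReal.ofReal_coe_nnreal, ← ENNReal.ofReal_mul C.coe_nonneg]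
  have := hb n
  exact (ENNReal.ofReal_lt_ofReal_iff (by positivity)).2 (by nlinarith)

section Sequence

variable {d : ℕ} {I : ℕ → Type*} [∀ n, Fintype (I n)] {S : ℕ → Type*} {P : Measure (Vec d)} {L : ℕ}

/-- The packing numbers of the near optimal sets for the pseudo-metric of the gradients are tight
at the scale `τ_n κ`. -/
theorem exists_eventually_measure_le_packingNumber_le [IsProbabilityMeasure P]
    [∀ n, Nonempty (I n)] [∀ n, Nonempty (S n)]
    {ψ : ∀ n, (I n → Vec d) → S n → ℝ}
    (hfin : ∀ n, ∀ᵐ x ∂(iidLaw (I n) P), optValue (ψ n) x ≠ ⊥)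
    (hint : ∀ n, Integrable (fun x => (optValue (ψ n) x).toReal) (iidLaw (I n) P))
    (hP : RejectionCondition P)
    {H : ∀ n, I n → (I n → Vec d) → S n → Vec d}
    {R : ∀ n, Fin L → (I n → Vec d) → (I n → Vec d) → S n → ℝ≥0}
    {R' : ∀ n, Fin L → (I n → Vec d) → ℝ≥0} {υ : Fin L → ℝ} {θ : ℕ → ℝ} {l : ℝ} {ς : ℕ → ℝ}
    {γ : Fin L → ℝ≥0∞} {ν ν' : Fin L → ℕ → ℝ} {τ : ℕ → ℝ}
    (hR'm : ∀ n j, Measurable (R' n j)) (hυ : ∀ j, 0 < υ j) (hθ : ∀ n, 0 < θ n) (hl : 0 ≤ l)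
    (hς : ∀ n, 0 < ς n) (hν : ∀ j n, 0 < ν j n) (hν' : ∀ j n, 0 < ν' j n) (hτ : ∀ n, 0 < τ n)
    (hTaylor : ∀ n, TaylorUpper (ψ n) (H n) (R n) (R' n))
    (hR : (∀ n j, Homogeneous (R n j) (υ j)) ∧
        (∀ j, ∀ ρ : ℕ → Measure (Vec d × Vec d), (∀ n, IsSubGaussianPair P (ρ n)) →
          IsBigOSeq (fun n => remainderSize (ρ n) (nearOptimal (ψ n) (θ n)) (R n j) (γ j)) (ν j)) ∨
      (∀ n j, MonotoneHomogeneous (R n j) (υ j)) ∧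
        (∀ j, IsBigOSeq (fun n => remainderSize (P.prod (stdGaussian (Vec d)))
          (nearOptimal (ψ n) (θ n)) (R n j) (γ j)) (ν j)))
    (hR' : ∀ j, IsBigOSeq
      (fun n => eLpNorm (fun x => (R' n j x : ℝ)) (1 + γ j) (iidLaw (I n) P)) (ν' j))
    (hH : IsBigOSeq (fun n => gradSize P (nearOptimal (ψ n) (θ n)) (H n) l) ς)
    (hθO : θ =O[atTop] fun n => τ n * stepSize (Fintype.card (I n) : ℝ) (τ n) (ς n) l
      (fun j => ν j n * ν' j n) υ)
    {κ η : ℝ} (hκ : 0 < κ) (hη : 0 < η) :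
    ∃ m : ℕ, ∀ᶠ n in atTop, iidLaw (I n) P {x | (m : ℕ∞) ≤
      packingNumber (gradDist fun i => H n i x) (τ n * κ) (nearOptimal (ψ n) (θ n) x)} ≤
        ENNReal.ofReal η := by
  obtain ⟨f, hf, hf0, hPf, hrej⟩ := hP
  obtain ⟨C, hC, hrej⟩ := hrej (1 + l) (by positivity)
  set s : ℕ → ℝ := fun n => stepSize (Fintype.card (I n) : ℝ) (τ n) (ς n) l
    (fun j => ν j n * ν' j n) υ with hs
  have hcard : ∀ n, (0 : ℝ) < Fintype.card (I n) := fun n => by exact_mod_cast Fintype.card_pos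
  have hs0 : ∀ n, 0 < s n := fun n =>
    stepSize_pos (hcard n) (hτ n) (hς n) fun j => mul_pos (hν j n) (hν' j n)
  have hprob : ∀ n c, IsProbabilityMeasure (resampleLaw f (s n) P c) := fun n c =>
    isProbabilityMeasure_resampleLaw hf0 (s n) P c
  have hV : ∀ n, IsReversibleMove f (s n) P (noiseLaw (resampleLaw f (s n) P)) (move f (s n)) :=
    fun n => isReversibleMove_move hf hf0 (hs0 n) hPf
  -- both alternatives provide dominating functions of the remainders
  have hdom : ∀ j, ∃ c : ℝ, 0 ≤ c ∧ ∀ᶠ n in atTop,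
      ∃ r : (I n → Vec d) × (I n → Vec d) × (I n → Noise d) → ℝ≥0∞, Measurable r ∧
        (∀ᵐ z ∂((iidLaw (I n) P).prod (auxLaw d (I n) (noiseLaw (resampleLaw f (s n) P)))),
          ∀ ω ∈ nearOptimal (ψ n) (θ n) z.1,
          (R n j z.1 (s n • moveAll (move f (s n)) z) ω : ℝ≥0∞) ≤
            ENNReal.ofReal (s n ^ (1 + υ j)) * r z) ∧
        LpBound ((iidLaw (I n) P).prod (auxLaw d (I n) (noiseLaw (resampleLaw f (s n) P))))
          (1 + (γ j)⁻¹) r (ENNReal.ofReal (c * ν j n)) := by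
    intro j
    rcases hR with ⟨hhom, hb⟩ | ⟨hhom, hb⟩
    · obtain ⟨c, hc, hcn⟩ := (hb j _ fun n => (hV n).isSubGaussianPair (hs0 n)).exists_lt (hν j)
      refine ⟨c, hc, hcn.mono fun n hn => ?_⟩
      exact exists_dominating_remainder (hV n).measurable (hs0 n)
        (ae_of_all _ fun z ω => (hhom n j _ _ _ (hs0 n) ω).le) hn
    · obtain ⟨c, hc, hcn⟩ := (hb j).exists_lt (hν j)
      refine ⟨c, hc, hcn.mono fun n hn => ?_⟩
      refine exists_dominating_remainder (G := fun z => z.2.1) (by fun_prop) (hs0 n)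
        ((hV n).ae_le_of_monotoneHomogeneous (hs0 n) (hhom n j)) ?_
      have h1 : MeasurePreserving (Prod.map id Prod.fst)
          (P.prod ((stdGaussian (Vec d)).prod (noiseLaw (resampleLaw f (s n) P))))
          (P.prod (stdGaussian (Vec d))) :=
        (MeasurePreserving.id P).prod measurePreserving_fst
      rw [← h1.map_eq] at hn
      exact hn
  choose c hc hdom using hdom
  choose c' hc' hR' using fun j => (hR' j).exists_lt (hν' j)
  obtain ⟨cH, hcH, hH⟩ := hH.exists_lt hς
  obtain ⟨a, ha0, ha⟩ := hθO.exists_nonneg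
  set A : ℝ := a + 2 * C ^ (1 / (1 + l)) * cH + ∑ j, c j * c' j with hA
  have hA0 : 0 ≤ A := add_nonneg (by positivity)
    (Finset.sum_nonneg fun j _ => mul_nonneg (hc j) (hc' j))
  -- the size of the packing is chosen so large that its price exceeds the errors
  set B : ℝ := (A + 1) / κ / η with hB
  have hB0 : 0 < B := by positivity
  refine ⟨sudakovCard B, ?_⟩
  filter_upwards [eventually_all.2 hdom, eventually_all.2 hR', hH, ha.bound] with n hdom hR' hH ha
  have hτn := hτ n
  refine (measure_le_packingNumber_nearOptimal_le (hs0 n) (hV n) (hfin n) (hint n) (hR'm n)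
    (hTaylor n) (hθ n) hl hC.le (mul_nonneg hcH (hς n).le)
    (fun j => mul_nonneg (hc j) (hν j n).le) (fun j => mul_nonneg (hc' j) (hν' j n).le)
    (lintegral_rejProb_le hf hf0 (by positivity) (hrej (s n) (hs0 n).le)) hH hdom
    (fun j => (hR' j).le) hB0 (by positivity)).trans (ENNReal.ofReal_le_ofReal ?_)
  have hθn : θ n ≤ a * (τ n * s n) := by
    have := hs0 n
    rwa [Real.norm_of_nonneg (hθ n).le, Real.norm_of_nonneg (by positivity)] at ha
  refine (error_div_le (hcard n) (hτ n) (hς n) (fun j => hν j n) (fun j => hν' j n) hl hυ rfl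
    hC.le hcH hc hc' hθn hB0 hκ).trans ?_
  rw [← hA, div_le_iff₀ hB0, hB]
  calc A / κ ≤ (A + 1) / κ := by gcongr; linarith
    _ = η * ((A + 1) / κ / η) := by field_simp

/-- Tightness passes from the random pseudo-metrics to the given metrics. The finitely many
remaining problems are covered by compactness. -/
theorem isTightFamily_of_comparison [∀ n, MetricSpace (S n)] [∀ n, CompactSpace (S n)]
    {T : ∀ n, (I n → Vec d) → Set (S n)} {Y : ∀ n, ℝ → (I n → Vec d) → ℕ∞} {ε₀ : ℝ} (hε₀ : 0 < ε₀)
    (hY : ∀ κ η : ℝ, 0 < κ → 0 < η → ∃ m : ℕ, ∀ᶠ n in atTop,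
      iidLaw (I n) P {x | (m : ℕ∞) ≤ Y n κ x} ≤ ENNReal.ofReal η)
    (hcomp : ∀ ε, 0 < ε → ε < ε₀ → ∀ δ : ℝ, 0 < δ → ∃ κ : ℝ, 0 < κ ∧ ∃ K : ℕ,
      limsup (fun n => iidLaw (I n) P {x | (K : ℕ∞) * Y n κ x <
        packingNumber (fun ω₁ ω₂ : S n => dist ω₁ ω₂) ε (T n x)}) atTop ≤ ENNReal.ofReal δ)
    {ε : ℝ} (hε : 0 < ε) :
    IsTightFamily (fun n => iidLaw (I n) P)
      (fun n x => packingNumber (fun ω₁ ω₂ : S n => dist ω₁ ω₂) ε (T n x)) := by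
  intro η hη
  have hε' : min ε (ε₀ / 2) < ε₀ := (min_le_right _ _).trans_lt (half_lt_self hε₀)
  obtain ⟨κ, hκ, K, hlim⟩ := hcomp (min ε (ε₀ / 2)) (by positivity) hε' (η / 3) (by positivity)
  obtain ⟨m, hm⟩ := hY κ (η / 2) hκ (by positivity)
  have hlt : ENNReal.ofReal (η / 3) < ENNReal.ofReal (η / 2) :=
    (ENNReal.ofReal_lt_ofReal_iff (by positivity)).2 (by linarith)
  have hev := eventually_lt_of_limsup_lt (hlim.trans_lt hlt)
  obtain ⟨n₀, hn₀⟩ := eventually_atTop.1 (hev.and hm)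
  obtain ⟨M₁, hM₁⟩ := Finset.exists_le ((Finset.range n₀).image fun n =>
    (packingNumber (fun ω₁ ω₂ : S n => dist ω₁ ω₂) ε Set.univ).toNat)
  refine ⟨max (K * m) M₁, fun n => ?_⟩
  rcases lt_or_ge n n₀ with hn | hn
  · refine le_of_eq_of_le ?_ zero_le
    convert measure_empty (μ := iidLaw (I n) P)
    refine Set.eq_empty_of_forall_notMem fun x hx => ?_
    have h1 : packingNumber (fun ω₁ ω₂ : S n => dist ω₁ ω₂) ε (T n x) ≤
        packingNumber (fun ω₁ ω₂ : S n => dist ω₁ ω₂) ε Set.univ :=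
      packingNumber_mono le_rfl (Set.subset_univ _)
    have h2 := ENat.natCast_toNat (packingNumber_lt_top hε (Set.univ : Set (S n))).ne
    have h3 := hM₁ _ (Finset.mem_image_of_mem _ (Finset.mem_range.2 hn))
    rw [← h2] at h1
    have h4 := lt_of_lt_of_le hx h1
    exact absurd h3 (not_le.2 ((le_max_right _ _).trans_lt (by exact_mod_cast h4)))
  · obtain ⟨h1, h2⟩ := hn₀ n hn
    calc _ ≤ iidLaw (I n) P ({x | (K : ℕ∞) * Y n κ x <
            packingNumber (fun ω₁ ω₂ : S n => dist ω₁ ω₂) (min ε (ε₀ / 2)) (T n x)} ∪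
          {x | (m : ℕ∞) ≤ Y n κ x}) := by
          refine measure_mono fun x hx => ?_
          rw [Set.mem_union, or_iff_not_imp_right]
          intro hx'
          have h3 : Y n κ x ≤ m := (not_le.1 hx').le
          have h4 : (K : ℕ∞) * Y n κ x ≤ (max (K * m) M₁ : ℕ) := by
            refine (mul_le_mul_right h3 _).trans ?_
            exact_mod_cast le_max_left _ _
          exact h4.trans_lt (lt_of_lt_of_le hx (packingNumber_mono (min_le_left _ _) le_rfl))
      _ ≤ ENNReal.ofReal (η / 2) + ENNReal.ofReal (η / 2) :=
          (measure_union_le _ _).trans (add_le_add h1.le h2)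
      _ = ENNReal.ofReal η := by
          rw [← ENNReal.ofReal_add (by positivity) (by positivity), add_halves]

end Sequence

/-! ### Linear objective functions -/

theorem gradSize_le_gradSizeLinear {d : ℕ} {I S : Type*} [Fintype I] {P : Measure (Vec d)}
    [IsProbabilityMeasure P] (T : (I → Vec d) → Set S) (h : I → S → Vec d) {l : ℝ} (hl : 0 ≤ l) :
    gradSize P T (fun i _ ω => h i ω) l ≤ gradSizeLinear h l := by
  rw [gradSize, gradSizeLinear]
  split_ifs
  · exact essSup_le_of_ae_le _ (ae_of_all _ fun x => iSup₂_le fun ω _ =>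
      le_iSup (fun ω => ⨆ i, ‖h i ω‖ₑ) ω)
  · refine ENNReal.rpow_le_rpow ?_ (by positivity)
    refine iInf_le_of_le (fun _ => ⨆ ω, ∑ i, ‖h i ω‖ₑ ^ ((1 + l) / l))
      (iInf_le_of_le measurable_const (iInf_le_of_le (fun x => iSup₂_le fun ω _ =>
        le_iSup (fun ω => ∑ i, ‖h i ω‖ₑ ^ ((1 + l) / l)) ω) ?_))
    simp

end NearOpt

end

theorem mainTheorem3 {d : ℕ} {I : ℕ → Type*} [∀ n, Fintype (I n)] [∀ n, Nonempty (I n)]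
    {S : ℕ → Type*} [∀ n, MetricSpace (S n)] [∀ n, CompactSpace (S n)] [∀ n, Nonempty (S n)]
    [∀ n, MeasurableSpace (S n)] [∀ n, BorelSpace (S n)]
    (hdiam : ∃ D : ℝ, ∀ n, Metric.diam (Set.univ : Set (S n)) ≤ D)
    (P : Measure (NearOpt.Vec d)) [IsProbabilityMeasure P]
    (ψ : ∀ n, (I n → NearOpt.Vec d) → S n → ℝ)
    (hψ : ∀ n, NearOpt.ObjectiveMeasurable P (ψ n))
    (hunique : ∀ n, NearOpt.UniqueMinimizer P (ψ n))
    (hmeas : ∀ n, NearOpt.OptimumMeasurable P (ψ n))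
    (hP : NearOpt.RejectionCondition P) :
    -- the general theorem
    (∀ (L : ℕ) (H : ∀ n, I n → (I n → NearOpt.Vec d) → S n → NearOpt.Vec d)
      (R : ∀ n, Fin L → (I n → NearOpt.Vec d) → (I n → NearOpt.Vec d) → S n → ℝ≥0)
      (R' : ∀ n, Fin L → (I n → NearOpt.Vec d) → ℝ≥0) (υ : Fin L → ℝ)
      (θ : ℕ → ℝ) (lam : ℝ) (ς : ℕ → ℝ) (γ : Fin L → ℝ≥0∞) (ν ν' : Fin L → ℕ → ℝ)
      (ε₀ : ℝ) (τ : ℕ → ℝ),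
      (∀ n i, Measurable fun z : (I n → NearOpt.Vec d) × S n => H n i z.1 z.2) →
      (∀ n j, Measurable fun z : (I n → NearOpt.Vec d) × (I n → NearOpt.Vec d) × S n =>
        R n j z.1 z.2.1 z.2.2) →
      (∀ n j, Measurable (R' n j)) →
      (∀ j, 0 < υ j) → (∀ n, 0 < θ n) → 0 ≤ lam → (∀ n, 0 < ς n) →
      (∀ j n, 0 < ν j n) → (∀ j n, 0 < ν' j n) → 0 < ε₀ → (∀ n, 0 < τ n) →
      -- Taylor-like upper expansion
      (∀ n, NearOpt.TaylorUpper (ψ n) (H n) (R n) (R' n)) →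
      -- either homogeneity of the remainders and moment bounds for all sub-Gaussian perturbations,
      -- or monotone homogeneity and moment bounds for independent Gaussian perturbations
      ((∀ n j, NearOpt.Homogeneous (R n j) (υ j)) ∧
          (∀ j, ∀ ρ : ℕ → Measure (NearOpt.Vec d × NearOpt.Vec d),
            (∀ n, NearOpt.IsSubGaussianPair P (ρ n)) →
            NearOpt.IsBigOSeq (fun n => NearOpt.remainderSize (ρ n)
              (NearOpt.nearOptimal (ψ n) (θ n)) (R n j) (γ j)) (ν j)) ∨
        (∀ n j, NearOpt.MonotoneHomogeneous (R n j) (υ j)) ∧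
          (∀ j, NearOpt.IsBigOSeq
            (fun n => NearOpt.remainderSize (P.prod (stdGaussian (NearOpt.Vec d)))
              (NearOpt.nearOptimal (ψ n) (θ n)) (R n j) (γ j)) (ν j))) →
      (∀ j, NearOpt.IsBigOSeq (fun n => eLpNorm (fun x => (R' n j x : ℝ)) (1 + γ j)
        (NearOpt.iidLaw (I n) P)) (ν' j)) →
      -- growth of the gradient terms
      NearOpt.IsBigOSeq (fun n =>
        NearOpt.gradSize P (NearOpt.nearOptimal (ψ n) (θ n)) (H n) lam) ς →
      -- comparison of `d_n` with the random pseudo-metric `d_{2,n}`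
      (∀ ε, 0 < ε → ε < ε₀ → ∀ δ : ℝ, 0 < δ → ∃ κ : ℝ, 0 < κ ∧ ∃ K : ℕ,
        limsup (fun n => NearOpt.iidLaw (I n) P
          {x | (K : ℕ∞) * NearOpt.packingNumber (NearOpt.gradDist fun i => H n i x) (τ n * κ)
                (NearOpt.nearOptimal (ψ n) (θ n) x) <
              NearOpt.packingNumber (fun ω₁ ω₂ : S n => dist ω₁ ω₂) ε
                (NearOpt.nearOptimal (ψ n) (θ n) x)}) atTop ≤ ENNReal.ofReal δ) →
      -- growth condition on the window lengths
      (θ =O[atTop] fun n => τ n *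
        Finset.univ.fold min (τ n ^ (1 + lam) / ((Fintype.card (I n) : ℝ) * ς n ^ (1 + lam)))
          (fun j => (τ n / (ν j n * ν' j n)) ^ (1 / υ j))) →
      ∀ ε, 0 < ε → NearOpt.IsTightFamily (fun n => NearOpt.iidLaw (I n) P)
        (fun n x => NearOpt.packingNumber (fun ω₁ ω₂ : S n => dist ω₁ ω₂) ε
          (NearOpt.nearOptimal (ψ n) (θ n) x))) ∧
    -- the linear theorem
    (∀ (H : ∀ n, I n → S n → NearOpt.Vec d) (θ : ℕ → ℝ) (lam : ℝ) (ς : ℕ → ℝ)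
      (ε₀ : ℝ) (τ : ℕ → ℝ),
      (∀ n i, Measurable (H n i)) →
      (∀ n x ω, ψ n x ω = ∑ i, inner ℝ (x i) (H n i ω)) →
      (∀ n, 0 < θ n) → 0 ≤ lam → (∀ n, 0 < ς n) → 0 < ε₀ → (∀ n, 0 < τ n) →
      NearOpt.IsBigOSeq (fun n => NearOpt.gradSizeLinear (H n) lam) ς →
      (∀ ε, 0 < ε → ε < ε₀ → ∃ κ : ℝ, 0 < κ ∧ ∃ K : ℕ, ∀ (n : ℕ) (B : Set (S n)),
        NearOpt.packingNumber (fun ω₁ ω₂ : S n => dist ω₁ ω₂) ε B ≤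
          (K : ℕ∞) * NearOpt.packingNumber (NearOpt.gradDist (H n)) (τ n * κ) B) →
      (θ =O[atTop] fun n =>
        τ n ^ (2 + lam) * (Fintype.card (I n) : ℝ)⁻¹ * ς n ^ (-1 - lam)) →
      ∀ ε, 0 < ε → NearOpt.IsTightFamily (fun n => NearOpt.iidLaw (I n) P)
        (fun n x => NearOpt.packingNumber (fun ω₁ ω₂ : S n => dist ω₁ ω₂) ε
          (NearOpt.nearOptimal (ψ n) (θ n) x))) := by
  have hfin := fun n => (hmeas n).optValue_finite
  have hint := fun n => (hmeas n).optValue_integrable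
  refine ⟨?_, ?_⟩
  · intro L H R R' υ θ lam ς γ ν ν' ε₀ τ _ _ hR'm hυ hθ hl hς hν hν' hε₀ hτ hTaylor hR hR' hH hcomp
      hθO ε hε
    exact NearOpt.isTightFamily_of_comparison hε₀ (fun κ η hκ hη =>
      NearOpt.exists_eventually_measure_le_packingNumber_le hfin hint hP hR'm hυ hθ hl hς hν hν' hτ
        hTaylor hR hR' hH hθO hκ hη) hcomp hε
  · intro H θ lam ς ε₀ τ _ hlin hθ hl hς hε₀ hτ hH hcomp hθO ε hε
    -- the general case without remainder terms
    have hθO' : θ =O[atTop] fun n => τ n * NearOpt.stepSize (Fintype.card (I n) : ℝ) (τ n) (ς n)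
        lam (fun j : Fin 0 => j.elim0) (fun j : Fin 0 => j.elim0) := by
      refine hθO.congr_right fun n => ?_
      have h1 := hτ n
      have h2 := hς n
      simp only [NearOpt.stepSize, Finset.univ_eq_empty, Finset.fold_empty]
      rw [show 2 + lam = 1 + (1 + lam) by ring, Real.rpow_add h1, Real.rpow_one,
        show -1 - lam = -(1 + lam) by ring, Real.rpow_neg h2.le]
      field_simp
    have hY := fun κ η (hκ : 0 < κ) (hη : 0 < η) =>
      NearOpt.exists_eventually_measure_le_packingNumber_le (L := 0) (R := fun _ j => j.elim0)
        (R' := fun _ j => j.elim0) (υ := fun j => j.elim0) (γ := fun j => j.elim0)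
        (ν := fun j => j.elim0) (ν' := fun j => j.elim0)
        (H := fun n i _ ω => H n i ω) hfin hint hP (fun _ j => j.elim0) (fun j => j.elim0) hθ hl hς
        (fun j => j.elim0) (fun j => j.elim0) hτ
        (fun n => ae_of_all _ fun z ω => by
          simp [hlin, inner_add_left, Finset.sum_add_distrib])
        (Or.inl ⟨fun _ j => j.elim0, fun j => j.elim0⟩) (fun j => j.elim0)
        (hH.imp fun C hC => hC.mono fun n hn =>
          (NearOpt.gradSize_le_gradSizeLinear _ (H n) hl).trans hn) (by convert hθO') hκ hη
    refine NearOpt.isTightFamily_of_comparison hε₀ hY (fun ε hε hε' δ _ => ?_) hε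
    obtain ⟨κ, hκ, K, hK⟩ := hcomp ε hε hε'
    refine ⟨κ, hκ, K, ?_⟩
    have hempty : ∀ n, {x | (K : ℕ∞) * NearOpt.packingNumber (NearOpt.gradDist (H n)) (τ n * κ)
          (NearOpt.nearOptimal (ψ n) (θ n) x) <
        NearOpt.packingNumber (fun ω₁ ω₂ : S n => dist ω₁ ω₂) ε
          (NearOpt.nearOptimal (ψ n) (θ n) x)} = ∅ := fun n =>
      Set.eq_empty_of_forall_notMem fun x hx => (not_lt.2 (hK n _)) hx
    simp only [hempty, measure_empty]
    simp
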